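/- Let $\Sigma$ be a finite alphabet and let $h:\Sigma^*\to\Sigma^*$ be a nonerasing morphism, that is, $h(a)$ is nonempty for every letter $a$. Let $\mathbf w=w_0w_1w_2\cdots=h^\omega(w_0)$, where $h$ is prolongable on $w_0$: $h(w_0)=w_0x$ with $x$ a nonempty word, and $\mathbf w$ is the infinite word that has all the words $h^n(w_0)$, $n\ge 0$, as prefixes. Let $\Delta\subsetneq\Sigma$ be a nonempty proper subalphabet. A $\Delta$-block of $\mathbf w$ is an occurrence $w_i\cdots w_j$ ($0\le i\le j$) all of whose letters lie in $\Delta$; it is maximal if $w_{j+1}\notin\Delta$ and either $i=0$ or $w_{i-1}\notin\Delta$. Suppose that $w_n\notin\Delta$ for infinitely many $n$ and that $\mathbf w$ contains $\Delta$-blocks of unbounded length. For $k=0,1,2,\ldots$ let $i_k$ and $j_k$ be the starting and ending positions of the $k$-th maximal $\Delta$-block of $\mathbf w$, counted from left to right. Then $\limsup_{k\to\infty} j_k/i_k$ is a (finite) algebraic number of degree at most $|\Sigma|$. If, moreover, $h$ is uniform, that is, all the words $h(a)$, $a\in\Sigma$, have the same length, then $\limsup_{k\to\infty} j_k/i_k$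 is rational. -/

import Mathlib

namespace MorphicWord

variable {A : Type*}

/-- The finite word `u` is a prefix of the infinite word `w = w 0, w 1, w 2, …`. -/
def IsPrefixOf (u : FreeMonoid A) (w : ℕ → A) : Prop :=
  u.toList = (List.range u.length).map w

/-- A morphism of words is nonerasing if no letter is mapped to the empty word. -/
def Nonerasing (h : FreeMonoid A →* FreeMonoid A) : Prop :=
  ∀ a : A, h (FreeMonoid.of a) ≠ 1

/-- A morphism of words is uniform if the images of all letters have the same length. -/
def Uniform (h : FreeMonoid A →* FreeMonoid A) : Prop :=
  ∃ m : ℕ, ∀ a : A, (h (FreeMonoid.of a)).length = m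

/-- `h` is prolongable on the letter `a`: `h(a) = a x` for a nonempty word `x`, none of whose
iterated images under `h` is empty. -/
def Prolongable (h : FreeMonoid A →* FreeMonoid A) (a : A) : Prop :=
  ∃ x : FreeMonoid A, h (FreeMonoid.of a) = FreeMonoid.of a * x ∧ ∀ n : ℕ, (⇑h)^[n] x ≠ 1

/-- `w = h^ω(a)`: the morphism `h` is prolongable on `a`, and the infinite word `w` is the limit of
the words `a, h(a), h²(a), …`. As `h` is prolongable on `a`, the lengths of these words are strictly
increasing, and the limit is the unique infinite word that has all of them as prefixes. -/
def IsOmegaLimit (h : FreeMonoid A →* FreeMonoid A) (a : A) (w : ℕ → A) : Prop :=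
  Prolongable h a ∧ ∀ n : ℕ, IsPrefixOf ((⇑h)^[n] (FreeMonoid.of a)) w

/-- The occurrence `w i, …, w j` is a (nonempty) `Δ`-block of `w`. -/
def IsBlock (w : ℕ → A) (Δ : Set A) (i j : ℕ) : Prop :=
  i ≤ j ∧ ∀ n : ℕ, i ≤ n → n ≤ j → w n ∈ Δ

/-- The occurrence `w i, …, w j` is a maximal `Δ`-block of `w`. -/
def IsMaximalBlock (w : ℕ → A) (Δ : Set A) (i j : ℕ) : Prop :=
  IsBlock w Δ i j ∧ w (j + 1) ∉ Δ ∧ (i = 0 ∨ w (i - 1) ∉ Δ)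

/-- The starting position of the `k`-th (`k = 0, 1, 2, …`) maximal `Δ`-block of `w`, for a word with
infinitely many maximal `Δ`-blocks. -/
noncomputable def blockStart (w : ℕ → A) (Δ : Set A) (k : ℕ) : ℕ :=
  Nat.nth (fun i => ∃ j : ℕ, IsMaximalBlock w Δ i j) k

/-- The ending position of the `k`-th maximal `Δ`-block of `w`: the only `j` for which the maximal
block that starts at the `k`-th starting position ends at `j`. -/
noncomputable def blockEnd (w : ℕ → A) (Δ : Set A) (k : ℕ) : ℕ :=
  sInf {j : ℕ | IsMaximalBlock w Δ (blockStart w Δ k) j}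

end MorphicWord

/-! A maximal block from i ≥ 1 to j fills the gap between consecutive positions s = i - 1 and t = j
+ 1 of letters outside Δ, so j/i = (t - 1)/(s + 1). Pulling sets of letters back along h acts on the
finite power set of Σ, so for some power g = h^p the set Γ of letters with g-image in Δ* is its own
preimage under g (`exists_idempotent_preimage`). A long gap of Δ runs from the last outside letter
of one g-image to the first outside letter of a later one, so it comes from a gap of Γ; in the same
way every gap of Γ descends from one of bounded length (`isGap_cases`, `exists_short_isGap`).

Descendants of short gaps far to the right have ratio close to 1, because every letter seen there
has already occurred many times (`exists_forall_markedPos_le`). Only finitely many short gaps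
remain. The endpoints of their n-th descendants, plus one, are sums of entries of M^n·1 for a
natural matrix M. A Perron-Frobenius argument that needs no irreducibility gives N and θ such that,
along n ↦ Nn, these entries are θ^n times polynomials in n over ℚ(θ), up to o(θ^n)
(`Matrix.exists_polynomial_asymptotics`). Hence along each residue class mod N the ratios converge
in ℚ(θ) (`exists_field_tendsto_div`). Away from 1 the sequence j_k/i_k accumulates at finitely many
points of ℚ(θ), which places its limsup there (`exists_limsup_eq_of_near_finite`).

The degree of θ is at most |Σ| because M is block triangular: θ is an eigenvalue of a power of the
incidence matrix of g, or else equals 1. For uniform h, θ is an integer. -/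

open Filter Topology

/-! ### Growth of iterates on generalized eigenspaces. -/

section GeneralizedEigenspaces

/-- Powers of an endomorphism on a generalized eigenvector. -/
theorem Module.End.pow_apply_of_pow_sub_apply_eq_zero {R V : Type*} [CommRing R] [AddCommGroup V]
    [Module R V] (T : Module.End R V) (c : R) {m : ℕ} {x : V}
    (hx : ((T - c • (1 : Module.End R V)) ^ m) x = 0) (n : ℕ) :
    (T ^ n) x = ∑ k ∈ Finset.range m,
      ((n.choose k : R) * c ^ (n - k)) • ((T - c • (1 : Module.End R V)) ^ k) x := by
  set f : Module.End R V := T - c • (1 : Module.End R V) with hf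
  have hT : T = f + c • (1 : Module.End R V) := by simp [hf]
  have hcomm : Commute f (c • (1 : Module.End R V)) := (Commute.one_right f).smul_right c
  have hvan : ∀ k, m ≤ k → (f ^ k) x = 0 := by
    intro k hk
    obtain ⟨l, rfl⟩ := Nat.exists_eq_add_of_le' hk
    rw [pow_add, Module.End.mul_apply, hx, map_zero]
  have hterm : ∀ k, (f ^ k * (c • (1 : Module.End R V)) ^ (n - k) * (n.choose k : Module.End R V)) x
      = ((n.choose k : R) * c ^ (n - k)) • (f ^ k) x := by
    intro k
    have h1 : (n.choose k : Module.End R V) = (n.choose k : R) • (1 : Module.End R V) := by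
      rw [← Algebra.algebraMap_eq_smul_one, map_natCast]
    rw [h1, smul_pow, one_pow]
    simp [smul_smul]
  have hsum : (T ^ n) x = ∑ k ∈ Finset.range (n + 1),
      ((n.choose k : R) * c ^ (n - k)) • (f ^ k) x := by
    rw [hT, hcomm.add_pow, LinearMap.sum_apply]
    exact Finset.sum_congr rfl fun k _ => hterm k
  rw [hsum]
  -- Both sums are padded with zero terms to a common range: binomial coefficients vanish beyond n,
  -- powers of `f` on `x` from m on.
  have e1 : ∑ k ∈ Finset.range (n + 1), ((n.choose k : R) * c ^ (n - k)) • (f ^ k) x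
      = ∑ k ∈ Finset.range (n + 1 + m), ((n.choose k : R) * c ^ (n - k)) • (f ^ k) x := by
    refine Finset.sum_subset (Finset.range_mono (by omega)) fun k _ hk => ?_
    rw [Nat.choose_eq_zero_of_lt (by simpa using hk)]
    simp
  have e2 : ∑ k ∈ Finset.range m, ((n.choose k : R) * c ^ (n - k)) • (f ^ k) x
      = ∑ k ∈ Finset.range (n + 1 + m), ((n.choose k : R) * c ^ (n - k)) • (f ^ k) x := by
    refine Finset.sum_subset (Finset.range_mono (by omega)) fun k _ hk => ?_
    rw [hvan k (by simpa using hk), smul_zero]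
  rw [e1, e2]

theorem Module.End.maxGenEigenspace_eq_bot_of_not_hasEigenvalue {R V : Type*} [CommRing R]
    [AddCommGroup V] [Module R V] (T : Module.End R V) {c : R} (hc : ¬ T.HasEigenvalue c) :
    T.maxGenEigenspace c = ⊥ := by
  by_contra hne
  exact hc (Module.End.HasUnifEigenvalue.lt (k := ⊤) (m := 1) (f := T) (μ := c) (by simp) hne)

theorem tendsto_choose_mul_pow_div_pow {s r : ℝ} (hs : 0 ≤ s) (hsr : s < r) (k : ℕ) :
    Tendsto (fun n : ℕ => (n.choose k : ℝ) * s ^ (n - k) / r ^ n) atTop (𝓝 0) := by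
  -- Unlike s, the intermediate t is positive, so t^(n-k) may be split as t^n / t^k, and t/r < 1
  -- still beats n^k.
  obtain ⟨t, hst, htr⟩ := exists_between hsr
  have ht : 0 < t := hs.trans_lt hst
  have hr : 0 < r := ht.trans htr
  have hlim : Tendsto (fun n : ℕ => ((n : ℝ) ^ k * (t / r) ^ n) * (t ^ k)⁻¹) atTop (𝓝 0) := by
    have := (tendsto_pow_const_mul_const_pow_of_abs_lt_one k
      (r := t / r) (by rw [abs_of_pos (by positivity), div_lt_one hr]; exact htr)).mul_const
      ((t ^ k)⁻¹)
    simpa using this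
  refine squeeze_zero' (Eventually.of_forall fun n => by positivity) ?_ hlim
  filter_upwards [eventually_ge_atTop k] with n hn
  have h1 : (n.choose k : ℝ) ≤ (n : ℝ) ^ k := by exact_mod_cast Nat.choose_le_pow n k
  have h2 : s ^ (n - k) ≤ t ^ n * (t ^ k)⁻¹ := by
    rw [← pow_sub₀ t ht.ne' hn]
    exact pow_le_pow_left₀ hs hst.le _
  calc (n.choose k : ℝ) * s ^ (n - k) / r ^ n
      ≤ (n : ℝ) ^ k * (t ^ n * (t ^ k)⁻¹) / r ^ n := by gcongr
    _ = ((n : ℝ) ^ k * (t / r) ^ n) * (t ^ k)⁻¹ := by rw [div_pow]; ring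

variable {V : Type*} [NormedAddCommGroup V] [NormedSpace ℂ V]

theorem tendsto_norm_pow_apply_div_pow_of_mem_maxGenEigenspace (T : Module.End ℂ V) {c : ℂ} {r : ℝ}
    (hr : ‖c‖ < r) {x : V} (hx : x ∈ T.maxGenEigenspace c) :
    Tendsto (fun n : ℕ => ‖(T ^ n) x‖ / r ^ n) atTop (𝓝 0) := by
  obtain ⟨m, hm⟩ := (Module.End.mem_maxGenEigenspace T c x).1 hx
  have hr0 : 0 < r := (norm_nonneg c).trans_lt hr
  have hlim : Tendsto (fun n : ℕ => ∑ k ∈ Finset.range m,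
      ((n.choose k : ℝ) * ‖c‖ ^ (n - k) / r ^ n) *
        ‖((T - c • (1 : Module.End ℂ V)) ^ k) x‖) atTop (𝓝 0) := by
    rw [show (0 : ℝ) = ∑ k ∈ Finset.range m,
      (0 : ℝ) * ‖((T - c • (1 : Module.End ℂ V)) ^ k) x‖ by simp]
    exact tendsto_finsetSum _ fun k _ =>
      (tendsto_choose_mul_pow_div_pow (norm_nonneg c) hr k).mul_const _
  refine squeeze_zero (fun n => by positivity) (fun n => ?_) hlim
  rw [T.pow_apply_of_pow_sub_apply_eq_zero c hm n, div_le_iff₀ (by positivity), Finset.sum_mul]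
  refine (norm_sum_le _ _).trans (Finset.sum_le_sum fun k _ => ?_)
  rw [norm_smul, norm_mul, norm_pow, Complex.norm_natCast]
  apply le_of_eq
  field_simp

theorem tendsto_norm_pow_apply_div_pow_of_forall_eigenvalue_lt [FiniteDimensional ℂ V]
    (T : Module.End ℂ V) {r : ℝ} (hr : ∀ c, T.HasEigenvalue c → ‖c‖ < r) (x : V) :
    Tendsto (fun n : ℕ => ‖(T ^ n) x‖ / r ^ n) atTop (𝓝 0) := by
  have hx : x ∈ ⨆ c, T.maxGenEigenspace c := by
    rw [Module.End.iSup_maxGenEigenspace_eq_top]; trivial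
  rcases subsingleton_or_nontrivial V with hV | hV
  · simp [Subsingleton.elim x 0]
  have hr0 : 0 ≤ r := by
    obtain ⟨c, hc⟩ := T.exists_eigenvalue
    exact (norm_nonneg c).trans (hr c hc).le
  refine Submodule.iSup_induction _ (motive := fun x =>
    Tendsto (fun n : ℕ => ‖(T ^ n) x‖ / r ^ n) atTop (𝓝 0)) hx (fun c y hy => ?_) (by simp)
    (fun y z hy hz => ?_)
  · by_cases hc : T.HasEigenvalue c
    · exact tendsto_norm_pow_apply_div_pow_of_mem_maxGenEigenspace T (hr c hc) hy
    · have hbot := T.maxGenEigenspace_eq_bot_of_not_hasEigenvalue hc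
      rw [hbot, Submodule.mem_bot] at hy
      simp [hy]
  · refine squeeze_zero (fun n => by positivity) (fun n => ?_) (by simpa using hy.add hz)
    rw [map_add, ← add_div]
    exact div_le_div_of_nonneg_right (norm_add_le _ _) (by positivity)

end GeneralizedEigenspaces

/-! ### Eigenvalues of maximal modulus of a nonnegative matrix. -/

section PeripheralEigenvalues

variable {ι : Type*} [Fintype ι]

theorem Matrix.mulVec_mono_of_nonneg {B : Matrix ι ι ℝ} (hB : ∀ i j, 0 ≤ B i j) {x y : ι → ℝ}
    (h : ∀ i, x i ≤ y i) (i : ι) : (B.mulVec x) i ≤ (B.mulVec y) i :=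
  Finset.sum_le_sum fun j _ => mul_le_mul_of_nonneg_left (h j) (hB i j)

variable [DecidableEq ι]

theorem Matrix.pow_nonneg_of_nonneg {B : Matrix ι ι ℝ} (hB : ∀ i j, 0 ≤ B i j) (n : ℕ) :
    ∀ i j, 0 ≤ (B ^ n) i j := by
  induction n with
  | zero => intro i j; rw [pow_zero, Matrix.one_apply]; split_ifs <;> norm_num
  | succ n ih =>
    intro i j
    rw [pow_succ, Matrix.mul_apply]
    exact Finset.sum_nonneg fun k _ => mul_nonneg (ih i k) (hB k j)

theorem Module.End.exists_eigenvalue_of_hasEigenvalue_pow {V : Type*} [AddCommGroup V] [Module ℂ V]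
    [FiniteDimensional ℂ V] (T : Module.End ℂ V) {n : ℕ} (hn : 0 < n) {c : ℂ}
    (hc : (T ^ n).HasEigenvalue c) : ∃ d, T.HasEigenvalue d ∧ c = d ^ n := by
  rw [Module.End.hasEigenvalue_iff_mem_spectrum, spectrum.map_pow_of_pos _ hn] at hc
  obtain ⟨d, hd, rfl⟩ := hc
  exact ⟨d, Module.End.hasEigenvalue_iff_mem_spectrum.2 hd, rfl⟩

/-- If a power of a nonnegative matrix expands a nonzero nonnegative vector by more than `r ^ L`,
then the matrix has an eigenvalue of modulus greater than `r`. -/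
theorem Matrix.exists_eigenvalue_gt_of_expanding {B : Matrix ι ι ℝ} (hB : ∀ i j, 0 ≤ B i j) {r : ℝ}
    (hr : 0 < r) {y : ι → ℝ} (hy : ∀ i, 0 ≤ y i) {i₀ : ι} (hi₀ : 0 < y i₀) {L : ℕ} (hL : 0 < L)
    (hexp : ∀ i, 0 < y i → r ^ L * y i < ((B ^ L).mulVec y) i) :
    ∃ c, Module.End.HasEigenvalue (Matrix.toLin' (B.map (algebraMap ℝ ℂ))) c ∧ r < ‖c‖ := by
  by_contra! hcon
  have hC := Matrix.pow_nonneg_of_nonneg hB L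
  set C := B ^ L with hCdef
  have hs : ∀ i, ∃ s, r ^ L < s ∧ s * y i ≤ (C.mulVec y) i := by
    intro i
    rcases (hy i).lt_or_eq with h | h
    · refine ⟨(C.mulVec y) i / y i, (lt_div_iff₀ h).2 (hexp i h), (div_mul_cancel₀ _ h.ne').le⟩
    · refine ⟨r ^ L + 1, by linarith, ?_⟩
      rw [← h, mul_zero]
      exact Finset.sum_nonneg fun j _ => mul_nonneg (hC i j) (hy j)
  choose s hs1 hs2 using hs
  have hne : (Finset.univ : Finset ι).Nonempty := ⟨i₀, Finset.mem_univ _⟩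
  -- One factor t > r^L with t·y ≤ C·y gives t^n·y ≤ C^n·y. If all eigenvalues of B had modulus at
  -- most r, those of C would be smaller than t, and C^n·y would be o(t^n).
  set t := Finset.univ.inf' hne s with ht
  have ht1 : r ^ L < t := (Finset.lt_inf'_iff _).2 fun i _ => hs1 i
  have ht0 : 0 < t := (pow_pos hr L).trans ht1
  have ht2 : ∀ i, t * y i ≤ (C.mulVec y) i := fun i =>
    (mul_le_mul_of_nonneg_right (Finset.inf'_le _ (Finset.mem_univ i)) (hy i)).trans (hs2 i)
  have hpow : ∀ n i, t ^ n * y i ≤ ((C ^ n).mulVec y) i := by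
    intro n
    induction n with
    | zero => intro i; simp
    | succ n ih =>
      intro i
      rw [pow_succ' C, ← Matrix.mulVec_mulVec]
      refine le_trans ?_ (Matrix.mulVec_mono_of_nonneg hC ih i)
      have : (C.mulVec fun j => t ^ n * y j) = t ^ n • C.mulVec y := by
        rw [← Matrix.mulVec_smul]; rfl
      rw [this, Pi.smul_apply, smul_eq_mul, pow_succ, mul_assoc]
      exact mul_le_mul_of_nonneg_left (ht2 i) (by positivity)
  set T : Module.End ℂ (ι → ℂ) := Matrix.toLin' (B.map (algebraMap ℝ ℂ)) with hT
  have hTL : T ^ L = Matrix.toLin' (C.map (algebraMap ℝ ℂ)) := by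
    rw [hT, hCdef, ← Matrix.toLin'_pow]
    congr 1
    exact (map_pow (algebraMap ℝ ℂ).mapMatrix B L).symm
  have heig : ∀ c, (T ^ L).HasEigenvalue c → ‖c‖ < t := by
    intro c hc
    obtain ⟨d, hd, rfl⟩ := T.exists_eigenvalue_of_hasEigenvalue_pow hL hc
    rw [norm_pow]
    exact (pow_le_pow_left₀ (norm_nonneg d) (hcon d hd) L).trans_lt ht1
  have hlim := tendsto_norm_pow_apply_div_pow_of_forall_eigenvalue_lt (T ^ L) heig
    (fun i => (y i : ℂ))
  have hge : ∀ n, y i₀ ≤ ‖((T ^ L) ^ n) (fun i => (y i : ℂ))‖ / t ^ n := by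
    intro n
    rw [le_div_iff₀ (by positivity), hTL, ← Matrix.toLin'_pow, Matrix.toLin'_apply]
    have h1 : ((C.map (algebraMap ℝ ℂ)) ^ n).mulVec (fun i => (y i : ℂ))
        = fun i => ((((C ^ n).mulVec y) i : ℝ) : ℂ) := by
      ext i
      rw [show (C.map (algebraMap ℝ ℂ)) ^ n = (C ^ n).map (algebraMap ℝ ℂ) from
        (map_pow (algebraMap ℝ ℂ).mapMatrix C n).symm]
      exact (RingHom.map_mulVec (algebraMap ℝ ℂ) (C ^ n) y i).symm
    rw [h1]
    refine le_trans ?_ (norm_le_pi_norm _ i₀)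
    rw [Complex.norm_real]
    exact (by linarith [hpow n i₀] : y i₀ * t ^ n ≤ _).trans (le_abs_self _)
  have := ge_of_tendsto' hlim hge
  linarith

/-- The eigenvalues of maximal modulus of a nonnegative matrix are, up to their modulus, roots
of unity. -/
theorem Matrix.exists_pow_eq_of_peripheral_eigenvalue {B : Matrix ι ι ℝ} (hB : ∀ i j, 0 ≤ B i j)
    {r : ℝ} (hr : 0 < r)
    (hmax : ∀ c, Module.End.HasEigenvalue (Matrix.toLin' (B.map (algebraMap ℝ ℂ))) c → ‖c‖ ≤ r) {a : ℂ}
    (ha : Module.End.HasEigenvalue (Matrix.toLin' (B.map (algebraMap ℝ ℂ))) a) (har : ‖a‖ = r) :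
    ∃ l : ℕ, 0 < l ∧ a ^ l = (r : ℂ) ^ l := by
  obtain ⟨z, hz⟩ := ha.exists_hasEigenvector
  have hz0 : z ≠ 0 := hz.2
  have hzB : ∀ i, ∑ j, (B i j : ℂ) * z j = a * z i := by
    intro i
    have := congrFun hz.apply_eq_smul i
    rw [Matrix.toLin'_apply] at this
    simpa [Matrix.mulVec, dotProduct] using this
  obtain ⟨i₁, hi₁⟩ : ∃ i, z i ≠ 0 := by
    by_contra! h; exact hz0 (funext h)
  set y : ι → ℝ := fun i => ‖z i‖ with hy
  have hy0 : ∀ i, 0 ≤ y i := fun i => norm_nonneg _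
  -- δ is the defect in the triangle inequality for the eigenvector equation; where it vanishes, the
  -- contributing `z j` are all aligned.
  set δ : ι → ℝ := fun i => (B.mulVec y) i - r * y i with hδ
  have hδ0 : ∀ i, 0 ≤ δ i := by
    intro i
    have h1 : r * y i = ‖∑ j, (B i j : ℂ) * z j‖ := by rw [hzB, norm_mul, har]
    have h2 : ‖∑ j, (B i j : ℂ) * z j‖ ≤ (B.mulVec y) i := by
      refine (norm_sum_le _ _).trans (Finset.sum_le_sum fun j _ => ?_)
      rw [norm_mul, Complex.norm_real, Real.norm_of_nonneg (hB i j)]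
    simp only [hδ]; linarith
  have hBy : B.mulVec y = r • y + δ := by ext i; simp [hδ]
  have hBn := Matrix.pow_nonneg_of_nonneg hB
  have hδn : ∀ n i, 0 ≤ ((B ^ n).mulVec δ) i := fun n i =>
    Finset.sum_nonneg fun j _ => mul_nonneg (hBn n i j) (hδ0 j)
  have hgrow : ∀ n i, r ^ n * y i ≤ ((B ^ n).mulVec y) i ∧
      ∀ k < n, 0 < ((B ^ k).mulVec δ) i → r ^ n * y i < ((B ^ n).mulVec y) i := by
    intro n
    induction n with
    | zero => intro i; simp
    | succ n ih =>
      intro i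
      have h1 : ((B ^ (n + 1)).mulVec y) i
          = r * ((B ^ n).mulVec y) i + ((B ^ n).mulVec δ) i := by
        rw [pow_succ, ← Matrix.mulVec_mulVec, hBy, Matrix.mulVec_add, Matrix.mulVec_smul]
        rfl
      have h2 : r ^ (n + 1) * y i = r * (r ^ n * y i) := by ring
      rw [h1, h2]
      refine ⟨by nlinarith [(ih i).1, hδn n i], fun k hk hpos => ?_⟩
      rcases Nat.lt_succ_iff_lt_or_eq.1 hk with h | rfl
      · have := mul_lt_mul_of_pos_left ((ih i).2 k h hpos) hr
        linarith [hδn n i]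
      · have := mul_le_mul_of_nonneg_left (ih i).1 hr.le
        linarith
  -- If the defect reaches every index of the support, a power of B expands y strictly, which yields
  -- an eigenvalue beyond r.
  by_cases hF : ∀ i, 0 < y i → ∃ k, 0 < ((B ^ k).mulVec δ) i
  · exfalso
    have hF' : ∀ i, ∃ k, 0 < y i → 0 < ((B ^ k).mulVec δ) i := by
      intro i
      by_cases h : 0 < y i
      · obtain ⟨k, hk⟩ := hF i h; exact ⟨k, fun _ => hk⟩
      · exact ⟨0, fun h' => absurd h' h⟩
    choose k hk using hF'
    obtain ⟨c, hc, hrc⟩ := Matrix.exists_eigenvalue_gt_of_expanding hB hr hy0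
      (i₀ := i₁) (norm_pos_iff.2 hi₁) (L := Finset.univ.sup k + 1) (Nat.succ_pos _)
      (fun i hi => (hgrow _ i).2 (k i)
        (Nat.lt_succ_of_le (Finset.le_sup (Finset.mem_univ i))) (hk i hi))
    exact absurd (hmax c hc) (not_le.2 hrc)
  · push Not at hF
    obtain ⟨i₀, hi₀, hi₀F⟩ := hF
    -- The indices that the defect never reaches. F is closed under following positive entries of B
    -- within the support, and each such step multiplies the phase of z by a/r.
    let F : Type _ := {i : ι // 0 < y i ∧ ∀ k, ((B ^ k).mulVec δ) i ≤ 0}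
    have hstep : ∀ i : F, ∃ j : F, z j / ‖z j‖ = (a / r) * (z i / ‖z i‖) := by
      rintro ⟨i, hiy, hiF⟩
      have hδi : δ i = 0 := le_antisymm (by simpa using hiF 0) (hδ0 i)
      have hsum : ∑ j, B i j * y j = r * y i := by
        have : (B.mulVec y) i - r * y i = 0 := hδi
        exact sub_eq_zero.1 this
      obtain ⟨j, hj⟩ : ∃ j, 0 < B i j * y j := by
        by_contra! h
        have := Finset.sum_nonpos fun j (_ : j ∈ Finset.univ) => h j
        have h3 : 0 < r * y i := by positivity
        linarith
      have hBij : 0 < B i j := lt_of_le_of_ne (hB i j) fun h => by rw [← h] at hj; simp at hj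
      have hyj : 0 < y j := lt_of_le_of_ne (hy0 j) fun h => by rw [← h] at hj; simp at hj
      refine ⟨⟨j, hyj, fun k => ?_⟩, ?_⟩
      · by_contra! hpos
        have h1 : ((B ^ (k + 1)).mulVec δ) i = ∑ l, B i l * ((B ^ k).mulVec δ) l := by
          rw [pow_succ', ← Matrix.mulVec_mulVec]; rfl
        have h2 : B i j * ((B ^ k).mulVec δ) j ≤ ((B ^ (k + 1)).mulVec δ) i := by
          rw [h1]
          exact Finset.single_le_sum (f := fun l => B i l * ((B ^ k).mulVec δ) l)
            (fun l _ => mul_nonneg (hB i l) (hδn k l)) (Finset.mem_univ j)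
        have h3 := mul_pos hBij hpos
        linarith [hiF (k + 1)]
      · have hzi : z i ≠ 0 := norm_pos_iff.1 hiy
        have hzj : z j ≠ 0 := norm_pos_iff.1 hyj
        have ha0 : a ≠ 0 := by rw [← norm_pos_iff, har]; exact hr
        set b : ℂ := a * z i with hb
        have hb0 : b ≠ 0 := mul_ne_zero ha0 hzi
        have hbn : ‖b‖ = r * y i := by rw [hb, norm_mul, har]
        -- The rotation that turns b = a·z_i onto the positive axis; equality in the triangle
        -- inequality then makes c·z_j positive as well.
        set c : ℂ := (starRingEnd ℂ) b / ‖b‖ with hc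
        have hbn0 : (‖b‖ : ℂ) ≠ 0 := by exact_mod_cast (norm_ne_zero_iff.2 hb0)
        have hcn : ‖c‖ = 1 := by
          rw [hc, norm_div, RCLike.norm_conj, Complex.norm_real, norm_norm,
            div_self (norm_ne_zero_iff.2 hb0)]
        have hcb : c * b = ‖b‖ := by
          rw [hc, div_mul_eq_mul_div, mul_comm, Complex.mul_conj, Complex.normSq_eq_norm_sq]
          push_cast
          field_simp
        have hre : ∑ l, B i l * (c * z l).re = ∑ l, B i l * y l := by
          rw [hsum, ← hbn]
          have := congrArg (fun x => (c * x).re) (hzB i)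
          simp only [← hb, hcb, Complex.ofReal_re] at this
          rw [← this, Finset.mul_sum, Complex.re_sum]
          refine Finset.sum_congr rfl fun l _ => ?_
          rw [mul_left_comm, Complex.re_ofReal_mul]
        have hle : ∀ l, (c * z l).re ≤ y l := by
          intro l
          refine (Complex.re_le_norm _).trans ?_
          rw [norm_mul, hcn, one_mul]
        have heq := (Finset.sum_eq_sum_iff_of_le fun l _ =>
          mul_le_mul_of_nonneg_left (hle l) (hB i l)).1 hre j (Finset.mem_univ j)
        have heq' : (c * z j).re = ‖c * z j‖ := by
          rw [norm_mul, hcn, one_mul]; exact mul_left_cancel₀ hBij.ne' heq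
        have hcz : c * z j = (y j : ℂ) := by
          have h0 := Complex.re_eq_norm.1 heq'
          have h5 : c * z j = ((c * z j).re : ℂ) := by
            apply Complex.ext
            · simp
            · simpa using (Complex.nonneg_iff.1 h0).2.symm
          rw [h5, heq', norm_mul, hcn, one_mul]
        have hc0 : c ≠ 0 := norm_ne_zero_iff.1 (by rw [hcn]; exact one_ne_zero)
        have hzi' : (‖z i‖ : ℂ) ≠ 0 := by exact_mod_cast hiy.ne'
        have hzj' : (‖z j‖ : ℂ) ≠ 0 := by exact_mod_cast hyj.ne'
        have hr' : (r : ℂ) ≠ 0 := by exact_mod_cast hr.ne'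
        have hbn' : (‖b‖ : ℂ) = r * ‖z i‖ := by rw [hbn]; push_cast; rfl
        have e1 : z j / ‖z j‖ = 1 / c := by
          rw [div_eq_div_iff hzj' hc0, one_mul, mul_comm]; exact hcz
        have e2 : (a / r) * (z i / ‖z i‖) = 1 / c := by
          rw [div_mul_div_comm, ← hb, ← hbn', div_eq_div_iff hbn0 hc0, one_mul, mul_comm]
          exact hcb
        simp only [e1, e2]
    choose nxt hnxt using hstep
    let i' : F := ⟨i₀, hi₀, hi₀F⟩
    have hiter : ∀ n, z (nxt^[n] i') / ‖z (nxt^[n] i')‖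
        = (a / r) ^ n * (z i' / ‖z i'‖) := by
      intro n
      induction n with
      | zero => simp
      | succ n ih => rw [Function.iterate_succ_apply', hnxt, ih, pow_succ']; ring
    -- A walk in the finite set F revisits an index, so two powers of a/r coincide.
    obtain ⟨m, n, hmn, heq⟩ := Finite.exists_ne_map_eq_of_infinite fun n : ℕ => nxt^[n] i'
    wlog hlt : m < n generalizing m n
    · exact this n m hmn.symm heq.symm (lt_of_le_of_ne (not_lt.1 hlt) hmn.symm)
    have hu : z i' / ‖z i'‖ ≠ 0 := by
      have h1 : z i' ≠ 0 := norm_pos_iff.1 hi₀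
      exact div_ne_zero h1 (by exact_mod_cast norm_ne_zero_iff.2 h1)
    have hr' : (r : ℂ) ≠ 0 := by exact_mod_cast hr.ne'
    have ha0 : a ≠ 0 := by rw [← norm_pos_iff, har]; exact hr
    have hq : a / r ≠ 0 := div_ne_zero ha0 hr'
    have h1 : (a / r) ^ m = (a / r) ^ n := by
      apply mul_right_cancel₀ hu
      rw [← hiter, ← hiter]
      rw [heq]
    refine ⟨n - m, by omega, ?_⟩
    have h2 : (a / r) ^ (n - m) = 1 := by
      have : (a / r) ^ m * (a / r) ^ (n - m) = (a / r) ^ m * 1 := by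
        rw [← pow_add, mul_one, h1]; congr 1; omega
      exact mul_left_cancel₀ (pow_ne_zero _ hq) this
    rw [div_pow, div_eq_one_iff_eq (pow_ne_zero _ hr')] at h2
    exact h2

end PeripheralEigenvalues

/-! ### Dominant eigenvalues and polynomial asymptotics. -/

section DominantEigenvalue

variable {ι : Type*} [Fintype ι]

theorem Matrix.natCast_mulVec_one {S : Type*} [NonAssocSemiring S] (C : Matrix ι ι ℕ) (i : ι) :
    (((C.mulVec 1) i : ℕ) : S) = ((C.map (Nat.castRingHom S)).mulVec 1) i := by
  refine (RingHom.map_mulVec (Nat.castRingHom S) C 1 i).trans ?_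
  congr 2
  ext j; simp

variable [DecidableEq ι]

/-- A nonnegative matrix, some entry of whose powers applied to the all-ones vector stays at
least `1`, has a power with a positive eigenvalue that strictly dominates all others. -/
theorem Matrix.exists_pow_dominant_eigenvalue {B : Matrix ι ι ℝ} (hB : ∀ i j, 0 ≤ B i j) (i₀ : ι)
    (h1 : ∀ n, 1 ≤ ((B ^ n).mulVec 1) i₀) :
    ∃ N : ℕ, 0 < N ∧ ∃ θ : ℝ, 1 ≤ θ ∧
      Module.End.HasEigenvalue ((Matrix.toLin' (B.map (algebraMap ℝ ℂ))) ^ N) (θ : ℂ) ∧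
      ∀ c, Module.End.HasEigenvalue ((Matrix.toLin' (B.map (algebraMap ℝ ℂ))) ^ N) c →
        c = θ ∨ ‖c‖ < θ := by
  set T : Module.End ℂ (ι → ℂ) := Matrix.toLin' (B.map (algebraMap ℝ ℂ)) with hT
  have : Nonempty ι := ⟨i₀⟩
  have hfin : {c | T.HasEigenvalue c}.Finite := T.finite_hasEigenvalue
  obtain ⟨c₀, hc₀⟩ := T.exists_eigenvalue
  obtain ⟨a, ha, hmax⟩ := hfin.exists_maximalFor (fun c : ℂ => ‖c‖) _ ⟨c₀, hc₀⟩
  have hmax' : ∀ c, T.HasEigenvalue c → ‖c‖ ≤ ‖a‖ := fun c hc => by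
    rcases le_total ‖c‖ ‖a‖ with h | h
    · exact h
    · exact hmax hc h
  -- Otherwise the powers of T would drive the all-ones vector to 0, against `h1`.
  have hr1 : 1 ≤ ‖a‖ := by
    by_contra! hlt
    have hlim := tendsto_norm_pow_apply_div_pow_of_forall_eigenvalue_lt T
      (fun c hc => (hmax' c hc).trans_lt hlt) 1
    have hge : ∀ n : ℕ, 1 ≤ ‖(T ^ n) 1‖ / 1 ^ n := by
      intro n
      rw [one_pow, div_one, hT, ← Matrix.toLin'_pow, Matrix.toLin'_apply]
      refine le_trans ?_ (norm_le_pi_norm _ i₀)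
      rw [show (B.map (algebraMap ℝ ℂ)) ^ n = (B ^ n).map (algebraMap ℝ ℂ) from
        (map_pow (algebraMap ℝ ℂ).mapMatrix B n).symm]
      have : (((B ^ n).map (algebraMap ℝ ℂ)).mulVec 1) i₀ = ((((B ^ n).mulVec 1) i₀ : ℝ) : ℂ) := by
        refine Eq.trans ?_ (RingHom.map_mulVec (algebraMap ℝ ℂ) (B ^ n) 1 i₀).symm
        congr 2
      rw [this, Complex.norm_real]
      exact (h1 n).trans (le_abs_self _)
    have := ge_of_tendsto' hlim hge
    linarith
  have hr : 0 < ‖a‖ := by linarith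
  have hl : ∀ c : ℂ, ∃ l : ℕ, 0 < l ∧ (T.HasEigenvalue c → ‖c‖ = ‖a‖ → c ^ l = (‖a‖ : ℂ) ^ l) := by
    intro c
    by_cases h : T.HasEigenvalue c ∧ ‖c‖ = ‖a‖
    · obtain ⟨l, hl, hl'⟩ := Matrix.exists_pow_eq_of_peripheral_eigenvalue hB hr hmax' h.1 h.2
      exact ⟨l, hl, fun _ _ => hl'⟩
    · exact ⟨1, one_pos, fun h1 h2 => absurd ⟨h1, h2⟩ h⟩
  choose l hl0 hl using hl
  -- A common multiple of the exponents, so that all peripheral eigenvalues acquire the same N-th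
  -- power.
  set N := ∏ c ∈ hfin.toFinset, l c with hN
  have hN0 : 0 < N := Finset.prod_pos fun c _ => hl0 c
  have hper : ∀ c, T.HasEigenvalue c → ‖c‖ = ‖a‖ → c ^ N = (‖a‖ : ℂ) ^ N := by
    intro c hc hca
    obtain ⟨k, hk⟩ : l c ∣ N := Finset.dvd_prod_of_mem l (hfin.mem_toFinset.2 hc)
    rw [hk, pow_mul, pow_mul, hl c hc hca]
  refine ⟨N, hN0, ‖a‖ ^ N, one_le_pow₀ hr1, ?_, ?_⟩
  · have h2 : ((‖a‖ ^ N : ℝ) : ℂ) = a ^ N := by push_cast; exact (hper a ha rfl).symm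
    rw [h2, Module.End.hasEigenvalue_iff_mem_spectrum, spectrum.map_pow_of_pos _ hN0]
    exact ⟨a, Module.End.hasEigenvalue_iff_mem_spectrum.1 ha, rfl⟩
  · intro c hc
    obtain ⟨d, hd, rfl⟩ := T.exists_eigenvalue_of_hasEigenvalue_pow hN0 hc
    rcases (hmax' d hd).lt_or_eq with h | h
    · right
      rw [norm_pow]
      exact pow_lt_pow_left₀ h (norm_nonneg _) hN0.ne'
    · left
      rw [hper d hd h]; push_cast; rfl

/-- The m-th power of T - θ kills the generalized eigenspace of θ, as m is at least the dimension,
and commutes with T, so it preserves the others, where iterates are o(θ^n). -/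
theorem Module.End.tendsto_norm_pow_apply_pow_sub_div_pow {V : Type*} [NormedAddCommGroup V]
    [NormedSpace ℂ V] [FiniteDimensional ℂ V] (T : Module.End ℂ V) {θ : ℝ} (hθ : 0 ≤ θ)
    (hdom : ∀ c, T.HasEigenvalue c → c = θ ∨ ‖c‖ < θ) {m : ℕ} (hm : Module.finrank ℂ V ≤ m)
    (x : V) :
    Tendsto (fun n : ℕ => ‖(T ^ n) (((T - (θ : ℂ) • (1 : Module.End ℂ V)) ^ m) x)‖ / θ ^ n)
      atTop (𝓝 0) := by
  set f : Module.End ℂ V := T - (θ : ℂ) • (1 : Module.End ℂ V) with hf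
  have hx : x ∈ ⨆ c, T.maxGenEigenspace c := by
    rw [Module.End.iSup_maxGenEigenspace_eq_top]; trivial
  refine Submodule.iSup_induction _ (motive := fun x =>
    Tendsto (fun n : ℕ => ‖(T ^ n) ((f ^ m) x)‖ / θ ^ n) atTop (𝓝 0)) hx (fun c y hy => ?_)
    (by simp) (fun y z hy hz => ?_)
  · by_cases hc : T.HasEigenvalue c
    · rcases hdom c hc with rfl | hlt
      · have h0 : (f ^ m) y = 0 := by
          rw [Module.End.maxGenEigenspace_eq_genEigenspace_finrank,
            Module.End.mem_genEigenspace_nat] at hy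
          obtain ⟨k, rfl⟩ := Nat.exists_eq_add_of_le' hm
          rw [pow_add, Module.End.mul_apply, LinearMap.mem_ker.1 hy, map_zero]
        simp [h0]
      · refine tendsto_norm_pow_apply_div_pow_of_mem_maxGenEigenspace T hlt ?_
        have hcomm : Commute T (f ^ m) := by
          refine Commute.pow_right ?_ m
          exact (Commute.refl T).sub_right ((Commute.one_right T).smul_right _)
        exact Module.End.mapsTo_maxGenEigenspace_of_comm hcomm c hy
    · rw [T.maxGenEigenspace_eq_bot_of_not_hasEigenvalue hc, Submodule.mem_bot] at hy
      simp [hy]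
  · refine squeeze_zero (fun n => by positivity) (fun n => ?_) (by simpa using hy.add hz)
    rw [map_add, map_add, ← add_div]
    exact div_le_div_of_nonneg_right (norm_add_le _ _) (by positivity)

theorem Matrix.map_natCast_pow {S : Type*} [Semiring S] (C : Matrix ι ι ℕ) (n : ℕ) :
    (C ^ n).map (Nat.castRingHom S) = (C.map (Nat.castRingHom S)) ^ n :=
  map_pow (Nat.castRingHom S).mapMatrix C n

/-- If `θ` dominates all other eigenvalues of the natural matrix `C`, then the entries of
`C ^ n * 1` are asymptotic to `θ ^ n` times polynomials over any real field containing `θ`. -/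
theorem Matrix.exists_polynomial_of_dominant_eigenvalue (C : Matrix ι ι ℕ) {K : Type*} [Field K]
    [Algebra K ℝ] (t : K) {θ : ℝ} (ht : algebraMap K ℝ t = θ) (hθ0 : 0 < θ)
    (hdom : ∀ c, Module.End.HasEigenvalue (Matrix.toLin' (C.map (Nat.castRingHom ℂ))) c →
      c = θ ∨ ‖c‖ < θ) :
    ∃ P : ι → Polynomial K, ∀ i, Tendsto (fun n : ℕ => ((((C ^ n).mulVec 1) i : ℕ) : ℝ) / θ ^ n
          - Polynomial.aeval (n : ℝ) (P i)) atTop (𝓝 0) := by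
  have : CharZero K := (algebraMap K ℝ).charZero
  set T : Module.End ℂ (ι → ℂ) := Matrix.toLin' (C.map (Nat.castRingHom ℂ)) with hT
  have ht0 : t ≠ 0 := by
    rintro rfl
    rw [map_zero] at ht
    exact hθ0.ne ht
  let φ : K →+* ℂ := (algebraMap ℝ ℂ).comp (algebraMap K ℝ)
  have hφt : φ t = (θ : ℂ) := by simp [φ, ht]
  let TK : Module.End K (ι → K) := Matrix.toLin' (C.map (Nat.castRingHom K))
  let f : Module.End K (ι → K) := TK - t • (1 : Module.End K (ι → K))
  let g : Module.End ℂ (ι → ℂ) := T - (θ : ℂ) • (1 : Module.End ℂ (ι → ℂ))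
  have hTφ : ∀ x, φ ∘ (TK x) = T (φ ∘ x) := by
    intro x
    ext i
    rw [hT, Matrix.toLin'_apply]
    refine (RingHom.map_mulVec φ _ x i).trans ?_
    congr 2
    ext a b; simp
  have hfφ : ∀ x, φ ∘ (f x) = g (φ ∘ x) := by
    intro x
    ext i
    have := congrFun (hTφ x) i
    simp only [Function.comp_apply] at this
    simp [f, g, this, hφt]
  have hiter : ∀ (n : ℕ) x, φ ∘ ((TK ^ n) x) = (T ^ n) (φ ∘ x) := by
    intro n
    induction n with
    | zero => intro x; rfl
    | succ n ih =>
      intro x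
      rw [pow_succ, pow_succ, Module.End.mul_apply, Module.End.mul_apply, ih, hTφ]
  have hfiter : ∀ (n : ℕ) x, φ ∘ ((f ^ n) x) = (g ^ n) (φ ∘ x) := by
    intro n
    induction n with
    | zero => intro x; rfl
    | succ n ih =>
      intro x
      rw [pow_succ, pow_succ, Module.End.mul_apply, Module.End.mul_apply, ih, hfφ]
  -- Fitting decomposition of the all-ones vector, made over K so that coefficients stay in K: the
  -- kernel part gives the polynomials, the range part only an o(θ^n) error, estimated over ℂ.
  obtain ⟨m, hm, hmι⟩ := (f.eventually_isCompl_ker_pow_range_pow.and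
    (eventually_ge_atTop (Module.finrank ℂ (ι → ℂ)))).exists
  obtain ⟨u, hu, v, hv, huv⟩ := Submodule.mem_sup.1
    (hm.sup_eq_top ▸ Submodule.mem_top : (1 : ι → K) ∈ LinearMap.ker (f ^ m) ⊔ _)
  obtain ⟨v', rfl⟩ := hv
  -- The binomial coefficient is written as a falling factorial over k!, a polynomial in n, and
  -- t^(n-k) as t^n / t^k.
  let P : ι → Polynomial K := fun i => ∑ k ∈ Finset.range m,
    Polynomial.C (((f ^ k) u) i * (t ^ k)⁻¹ * ((k.factorial : K))⁻¹) * descPochhammer K k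
  have hP : ∀ (n : ℕ) i, ((TK ^ n) u) i = t ^ n * (P i).eval (n : K) := by
    intro n i
    rw [TK.pow_apply_of_pow_sub_apply_eq_zero t hu n, Finset.sum_apply, Polynomial.eval_finsetSum,
      Finset.mul_sum]
    refine Finset.sum_congr rfl fun k _ => ?_
    rw [Polynomial.eval_mul, Polynomial.eval_C, descPochhammer_eval_eq_descFactorial,
      Nat.descFactorial_eq_factorial_mul_choose, Pi.smul_apply, smul_eq_mul]
    have hk : (k.factorial : K) ≠ 0 := Nat.cast_ne_zero.2 (Nat.factorial_ne_zero k)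
    rcases le_or_gt k n with h | h
    · rw [pow_sub₀ t ht0 h]
      push_cast
      field_simp
      rfl
    · rw [Nat.choose_eq_zero_of_lt h]; simp
  have hPℝ : ∀ (n : ℕ) i, Polynomial.aeval (n : ℝ) (P i) = algebraMap K ℝ ((P i).eval (n : K)) := by
    intro n i
    rw [← map_natCast (algebraMap K ℝ) n, Polynomial.aeval_algebraMap_apply,
      Polynomial.coe_aeval_eq_eval]
  have herr : ∀ (n : ℕ) i, ((((C ^ n).mulVec 1) i : ℕ) : ℝ) / θ ^ n
      - Polynomial.aeval (n : ℝ) (P i)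
      = algebraMap K ℝ (((TK ^ n) ((f ^ m) v')) i) / θ ^ n := by
    intro n i
    have h2 : ((((C ^ n).mulVec 1) i : ℕ) : K)
        = t ^ n * (P i).eval (n : K) + ((TK ^ n) ((f ^ m) v')) i := by
      rw [← hP, ← Pi.add_apply, ← map_add, huv, Matrix.natCast_mulVec_one, Matrix.map_natCast_pow]
      simp only [TK]
      rw [← Matrix.toLin'_pow, Matrix.toLin'_apply]
    have h3 := congrArg (algebraMap K ℝ) h2
    rw [map_natCast, map_add, map_mul, map_pow, ht, ← hPℝ] at h3
    rw [h3]
    have : θ ^ n ≠ 0 := by positivity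
    field_simp
    ring
  have hlim : ∀ i, Tendsto (fun n : ℕ => ((((C ^ n).mulVec 1) i : ℕ) : ℝ) / θ ^ n
      - Polynomial.aeval (n : ℝ) (P i)) atTop (𝓝 0) := by
    intro i
    have h4 := T.tendsto_norm_pow_apply_pow_sub_div_pow hθ0.le hdom hmι (φ ∘ v')
    refine squeeze_zero_norm (fun n => ?_) h4
    rw [herr, norm_div, Real.norm_of_nonneg (by positivity : 0 ≤ θ ^ n)]
    refine div_le_div_of_nonneg_right ?_ (by positivity)
    have h5 : ‖algebraMap K ℝ (((TK ^ n) ((f ^ m) v')) i)‖ = ‖(φ ∘ ((TK ^ n) ((f ^ m) v'))) i‖ :=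
      (Complex.norm_real _).symm
    rw [h5, hiter, hfiter]
    exact norm_le_pi_norm _ i
  exact ⟨P, hlim⟩

open IntermediateField in
/-- The iterates of a nonnegative integer matrix on the all-ones vector grow, along an arithmetic
progression, like a polynomial over `ℚ(θ)` times `θ ^ n`, with `θ` a dominant eigenvalue. -/
theorem Matrix.exists_polynomial_asymptotics (B : Matrix ι ι ℕ) (i₀ : ι)
    (h1 : ∀ n, 1 ≤ ((B ^ n).mulVec 1) i₀) :
    ∃ N : ℕ, 0 < N ∧ ∃ θ : ℝ, 1 ≤ θ ∧
      (∃ z : ι → ℂ, z ≠ 0 ∧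
        ((B ^ N).map (Nat.castRingHom ℂ)).mulVec z = (θ : ℂ) • z) ∧
      ∃ P : ι → Polynomial ℚ⟮θ⟯, (∃ i, P i ≠ 0) ∧
        ∀ i, Tendsto (fun n : ℕ => ((((B ^ (N * n)).mulVec 1) i : ℕ) : ℝ) / θ ^ n
          - Polynomial.aeval (n : ℝ) (P i)) atTop (𝓝 0) := by
  have hBC : (B.map (Nat.castRingHom ℝ)).map (algebraMap ℝ ℂ) = B.map (Nat.castRingHom ℂ) := by
    ext i j; simp
  obtain ⟨N, hN, θ, hθ, heig, hdom⟩ := Matrix.exists_pow_dominant_eigenvalue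
    (B := B.map (Nat.castRingHom ℝ)) (fun i j => by simp) i₀ (fun n => by
      rw [← Matrix.map_natCast_pow, ← Matrix.natCast_mulVec_one]; exact_mod_cast h1 n)
  rw [hBC, ← Matrix.toLin'_pow, ← Matrix.map_natCast_pow] at heig hdom
  set C := B ^ N with hC
  set T : Module.End ℂ (ι → ℂ) := Matrix.toLin' (C.map (Nat.castRingHom ℂ)) with hT
  have hθ0 : 0 < θ := by linarith
  obtain ⟨z, hz⟩ := heig.exists_hasEigenvector
  have hTz : (C.map (Nat.castRingHom ℂ)).mulVec z = (θ : ℂ) • z := by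
    rw [← Matrix.toLin'_apply]; exact hz.apply_eq_smul
  obtain ⟨P, hlim'⟩ := Matrix.exists_polynomial_of_dominant_eigenvalue C
    (θ := θ)
    (⟨θ, mem_adjoin_simple_self ℚ θ⟩ : ℚ⟮θ⟯) rfl hθ0 hdom
  have hlim : ∀ i, Tendsto (fun n : ℕ => ((((B ^ (N * n)).mulVec 1) i : ℕ) : ℝ) / θ ^ n
      - Polynomial.aeval (n : ℝ) (P i)) atTop (𝓝 0) := by
    simpa only [pow_mul, ← hC] using hlim'
  refine ⟨N, hN, θ, hθ, ⟨z, hz.2, hTz⟩, P, ?_, hlim⟩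
  by_contra! hP0
  obtain ⟨i, hi⟩ : ∃ i, z i ≠ 0 := by
    by_contra! h; exact hz.2 (funext h)
  have hzn : ∀ n, (T ^ n) z = (θ : ℂ) ^ n • z := by
    intro n
    induction n with
    | zero => simp
    | succ n ih =>
      rw [pow_succ', Module.End.mul_apply, ih, map_smul, hT, Matrix.toLin'_apply, hTz, smul_smul,
        pow_succ]
  -- The eigenvector bounds growth from below: |z_i|·θ^n = |(C^n z)_i| ≤ ‖z‖·(C^n 1)_i, so not all
  -- polynomials can vanish.
  have hlow : ∀ n : ℕ, ‖z i‖ ≤ ‖z‖ * (((((B ^ (N * n)).mulVec 1) i : ℕ) : ℝ) / θ ^ n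
      - Polynomial.aeval (n : ℝ) (P i)) := by
    intro n
    rw [hP0 i, map_zero, sub_zero, ← mul_div_assoc, le_div_iff₀ (by positivity)]
    have h6 : ‖((T ^ n) z) i‖ = ‖z i‖ * θ ^ n := by
      rw [hzn, Pi.smul_apply, norm_smul, norm_pow, Complex.norm_real, Real.norm_of_nonneg hθ0.le,
        mul_comm]
    rw [← h6, hT, ← Matrix.toLin'_pow, ← Matrix.map_natCast_pow, Matrix.toLin'_apply, pow_mul, ← hC]
    refine (norm_sum_le _ _).trans ?_
    have h7 : ((((C ^ n).mulVec 1) i : ℕ) : ℝ) = ∑ j, ((C ^ n) i j : ℝ) := by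
      simp [Matrix.mulVec, dotProduct]
    rw [h7, Finset.mul_sum]
    refine Finset.sum_le_sum fun j _ => ?_
    rw [norm_mul, mul_comm]
    refine mul_le_mul (norm_le_pi_norm z j) ?_ (norm_nonneg _) (norm_nonneg _)
    simp
  have := ge_of_tendsto' ((hlim i).const_mul ‖z‖) hlow
  rw [mul_zero] at this
  exact absurd (norm_le_zero_iff.1 this) hi

end DominantEigenvalue

/-! ### Limits of ratios of asymptotically polynomial sequences. -/

section PolynomialRatio

open Polynomial

/-- Both sequences are compared with n^d, d = deg Q. The bound `hab` prevents deg P from exceeding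
d, so the limit is the quotient of the coefficients at d, which lies in K. -/
theorem Polynomial.tendsto_div_of_sub_tendsto_zero {K : Type*} [Field K] [Algebra K ℝ]
    {a b : ℕ → ℝ} {P Q : K[X]} (hQ : Q ≠ 0)
    (ha : Tendsto (fun n : ℕ => a n - aeval (n : ℝ) P) atTop (𝓝 0))
    (hb : Tendsto (fun n : ℕ => b n - aeval (n : ℝ) Q) atTop (𝓝 0)) {M : ℝ}
    (hab : ∀ n, |a n| ≤ M * |b n|) :
    ∃ v : K, Tendsto (fun n => a n / b n) atTop (𝓝 (algebraMap K ℝ v)) := by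
  set d := Q.natDegree with hd
  have hX : ((X : ℝ[X]) ^ d).degree = d := degree_X_pow d
  have hX0 : ((X : ℝ[X]) ^ d) ≠ 0 := pow_ne_zero _ X_ne_zero
  have heval : ∀ (R : K[X]) (x : ℝ), aeval x R = (R.map (algebraMap K ℝ)).eval x := fun R x => by
    rw [eval_map_algebraMap]
  have hsmall : ∀ {c : ℕ → ℝ}, Tendsto c atTop (𝓝 0) →
      Tendsto (fun n : ℕ => c n / (n : ℝ) ^ d) atTop (𝓝 0) := by
    intro c hc
    refine squeeze_zero_norm' ?_ (tendsto_zero_iff_norm_tendsto_zero.1 hc)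
    filter_upwards [eventually_ge_atTop 1] with n hn
    rw [norm_div]
    refine div_le_self (norm_nonneg _) ?_
    rw [norm_pow, Real.norm_natCast]
    exact one_le_pow₀ (by exact_mod_cast hn)
  have hmain : ∀ {c : ℕ → ℝ} {R : K[X]}, R.natDegree ≤ d →
      Tendsto (fun n : ℕ => c n - aeval (n : ℝ) R) atTop (𝓝 0) →
      Tendsto (fun n : ℕ => c n / (n : ℝ) ^ d) atTop (𝓝 (algebraMap K ℝ (R.coeff d))) := by
    intro c R hR hc
    have h1 : Tendsto (fun n : ℕ => aeval (n : ℝ) R / (n : ℝ) ^ d) atTop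
        (𝓝 (algebraMap K ℝ (R.coeff d))) := by
      set S := R.map (algebraMap K ℝ) with hS
      have h2 : Tendsto (fun x : ℝ => S.eval x / (X ^ d : ℝ[X]).eval x) atTop
          (𝓝 (algebraMap K ℝ (R.coeff d))) := by
        rcases hR.lt_or_eq with h | h
        · rw [coeff_eq_zero_of_natDegree_lt h, map_zero]
          refine div_tendsto_atTop_zero_of_degree_lt S _ ?_
          rw [hX]
          refine lt_of_le_of_lt degree_le_natDegree ?_
          rw [hS, natDegree_map]
          exact_mod_cast h
        · by_cases hR0 : R = 0
          · simp [hS, hR0]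
          have := div_tendsto_atTop_leadingCoeff_div_of_degree_eq S (X ^ d) (by
            rw [hX, hS, degree_map, degree_eq_natDegree hR0, h])
          rw [hS, leadingCoeff_map, leadingCoeff, h] at this
          simpa [hS] using this
      have h3 := h2.comp tendsto_natCast_atTop_atTop
      refine h3.congr fun n => ?_
      rw [heval, ← hS, Function.comp_apply, eval_pow, eval_X]
    have h4 := (hsmall hc).add h1
    rw [zero_add] at h4
    refine h4.congr fun n => ?_
    ring
  have hlb := hmain le_rfl hb
  have hlc : algebraMap K ℝ (Q.coeff d) ≠ 0 := by
    refine (_root_.map_ne_zero _).2 ?_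
    exact leadingCoeff_ne_zero.2 hQ
  have hdeg : P.natDegree ≤ d := by
    by_contra! hlt
    set S := P.map (algebraMap K ℝ) with hS
    have h2 : Tendsto (fun x : ℝ => |S.eval x / (X ^ d : ℝ[X]).eval x|) atTop atTop := by
      refine abs_div_tendsto_atTop_atTop_of_degree_gt S _ ?_ hX0
      rw [hX, hS, degree_map, degree_eq_natDegree (by rintro rfl; simp at hlt)]
      exact_mod_cast hlt
    have h3 := h2.comp (tendsto_natCast_atTop_atTop (R := ℝ))
    have h5 : Tendsto (fun n : ℕ => M * |b n / (n : ℝ) ^ d|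
        + |(a n - aeval (n : ℝ) P) / (n : ℝ) ^ d|) atTop
        (𝓝 (M * |algebraMap K ℝ (Q.coeff d)| + |0|)) :=
      (hlb.abs.const_mul M).add (hsmall ha).abs
    refine not_tendsto_nhds_of_tendsto_atTop (tendsto_atTop_mono (fun n => ?_) h3) _ h5
    have h6 : S.eval (n : ℝ) / (X ^ d : ℝ[X]).eval (n : ℝ)
        = a n / (n : ℝ) ^ d - (a n - aeval (n : ℝ) P) / (n : ℝ) ^ d := by
      rw [heval, hS]; simp; ring
    simp only [Function.comp_apply]
    rw [h6]
    refine (abs_sub _ _).trans ?_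
    gcongr
    rw [abs_div, abs_div, ← mul_div_assoc]
    exact div_le_div_of_nonneg_right (hab n) (abs_nonneg _)
  have hla := hmain hdeg ha
  refine ⟨P.coeff d / Q.coeff d, ?_⟩
  rw [map_div₀]
  refine (hla.div hlb hlc).congr' ?_
  filter_upwards [eventually_ge_atTop 1] with n hn
  have : ((n : ℝ) ^ d) ≠ 0 := pow_ne_zero _ (by exact_mod_cast (by omega : n ≠ 0))
  simp only [Pi.div_apply]
  rw [div_div_div_cancel_right₀ this]

end PolynomialRatio

/-! ### Substitutions, image positions and their growth. -/

/-- A nonerasing substitution: the letter `a` is replaced by the word of length `len a` whose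
letters are `letter a 0, letter a 1, …`. -/
structure LetterSubstitution (A : Type*) where
  len : A → ℕ
  letter : A → ℕ → A
  len_pos : ∀ a, 0 < len a

namespace LetterSubstitution

variable {A : Type*} (S : LetterSubstitution A) (w : ℕ → A)

/-- The position at which the image of the `n`-th letter of `w` starts. -/
def imagePos (n : ℕ) : ℕ := ∑ k ∈ Finset.range n, S.len (w k)

/-- The infinite word `w` is fixed by the substitution. -/
def Fixes : Prop := ∀ n r, r < S.len (w n) → w (S.imagePos w n + r) = S.letter (w n) r

/-- The position, in the image of the `n`-th letter of `w`, with offset given by `o`. -/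
def markedPos (o : A → ℕ) (n : ℕ) : ℕ := S.imagePos w n + o (w n)

@[simp] theorem imagePos_zero : S.imagePos w 0 = 0 := rfl

theorem imagePos_succ (n : ℕ) : S.imagePos w (n + 1) = S.imagePos w n + S.len (w n) :=
  Finset.sum_range_succ _ _

theorem imagePos_strictMono : StrictMono (S.imagePos w) :=
  strictMono_nat_of_lt_succ fun n => by rw [imagePos_succ]; exact Nat.lt_add_of_pos_right (S.len_pos _)

theorem sum_range_imagePos {w : ℕ → A} (hw : S.Fixes w) (f : A → ℕ) (m : ℕ) :
    ∑ k ∈ Finset.range (S.imagePos w m), f (w k)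
      = ∑ k ∈ Finset.range m, ∑ r ∈ Finset.range (S.len (w k)), f (S.letter (w k) r) := by
  induction m with
  | zero => simp
  | succ m ih =>
    rw [imagePos_succ, Finset.sum_range_add, ih, Finset.sum_range_succ]
    congr 1
    exact Finset.sum_congr rfl fun r hr => by rw [hw m r (Finset.mem_range.1 hr)]

/-- The letter gained in the image of `w 0` pushes every later position to the right. This makes the
descent of gaps terminate and lets the iterated images of `w 0` cover every prefix. -/
theorem add_two_le_imagePos_succ (h2 : 2 ≤ S.len (w 0)) (k : ℕ) : k + 2 ≤ S.imagePos w (k + 1) := by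
  induction k with
  | zero => simpa [imagePos] using h2
  | succ k ih => rw [imagePos_succ]; have := S.len_pos (w (k + 1)); omega

theorem succ_le_iterate_imagePos (h2 : 2 ≤ S.len (w 0)) (p : ℕ) :
    p + 1 ≤ (S.imagePos w)^[p] 1 := by
  induction p with
  | zero => simp
  | succ p ih =>
    rw [Function.iterate_succ_apply']
    refine le_trans ?_ ((S.imagePos_strictMono w).monotone ih)
    exact S.add_two_le_imagePos_succ w h2 p

section Growth

variable [Fintype A] [DecidableEq A]

/-- The incidence matrix of a substitution. -/
def incidence : Matrix A A ℕ :=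
  Matrix.of fun a c => ((Finset.range (S.len a)).filter (S.letter a · = c)).card

/-- The incidence matrix of a substitution extended by marked letters `(a, b)`: the image of such a
letter is the prefix of length `o b a` of the image of `a`, followed by the next letter, marked. -/
def markedMatrix (o : Bool → A → ℕ) : Matrix (A ⊕ A × Bool) (A ⊕ A × Bool) ℕ :=
  Matrix.fromBlocks S.incidence 0
    (Matrix.of fun x c => ((Finset.range (o x.2 x.1)).filter (S.letter x.1 · = c)).card)
    (Matrix.of fun x y => if y = (S.letter x.1 (o x.2 x.1), x.2) then 1 else 0)

/-- The lengths of the iterated images of the letters and of the marked letters. -/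
def growth (o : Bool → A → ℕ) (n : ℕ) : A ⊕ A × Bool → ℕ := (S.markedMatrix o ^ n).mulVec 1

variable (o : Bool → A → ℕ)

@[simp] theorem growth_zero (x : A ⊕ A × Bool) : S.growth o 0 x = 1 := by simp [growth]

theorem growth_succ (n : ℕ) : S.growth o (n + 1) = (S.markedMatrix o).mulVec (S.growth o n) := by
  rw [growth, growth, Matrix.mulVec_mulVec, pow_succ']

theorem sum_card_filter_mul (f : ℕ → A) (N : ℕ) (F : A → ℕ) :
    ∑ c, ((Finset.range N).filter (f · = c)).card * F c = ∑ r ∈ Finset.range N, F (f r) := by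
  rw [← Finset.sum_fiberwise (Finset.range N) f fun r => F (f r)]
  refine Finset.sum_congr rfl fun c _ => ?_
  rw [Finset.sum_congr rfl fun r hr => by rw [(Finset.mem_filter.1 hr).2], Finset.sum_const,
    smul_eq_mul]

theorem growth_succ_inl (n : ℕ) (a : A) : S.growth o (n + 1) (Sum.inl a)
    = ∑ r ∈ Finset.range (S.len a), S.growth o n (Sum.inl (S.letter a r)) := by
  rw [growth_succ, ← sum_card_filter_mul (S.letter a) (S.len a)
    fun c => S.growth o n (Sum.inl c)]
  simp [markedMatrix, Matrix.mulVec, dotProduct, incidence]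

theorem growth_succ_inr (n : ℕ) (a : A) (b : Bool) : S.growth o (n + 1) (Sum.inr (a, b))
    = ∑ r ∈ Finset.range (o b a), S.growth o n (Sum.inl (S.letter a r))
      + S.growth o n (Sum.inr (S.letter a (o b a), b)) := by
  rw [growth_succ, ← sum_card_filter_mul (S.letter a) (o b a)
    fun c => S.growth o n (Sum.inl c)]
  simp [markedMatrix, Matrix.mulVec, dotProduct]

variable {w} in
theorem iterate_imagePos (hw : S.Fixes w) (n m : ℕ) :
    (S.imagePos w)^[n] m = ∑ k ∈ Finset.range m, S.growth o n (Sum.inl (w k)) := by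
  induction n generalizing m with
  | zero => simp
  | succ n ih =>
    rw [Function.iterate_succ_apply, ih,
      S.sum_range_imagePos hw fun c => S.growth o n (Sum.inl c)]
    exact Finset.sum_congr rfl fun k _ => (S.growth_succ_inl o n (w k)).symm

variable {o}

variable {w} in
-- Position plus one is the length of the prefix that includes the marked letter. Counting that
-- letter makes the recursion linear with the all-ones vector as initial value.
theorem iterate_markedPos_add_one (ho : ∀ b a, o b a < S.len a)
    (hw : S.Fixes w) (b : Bool) (n m : ℕ) :
    (S.markedPos w (o b))^[n] m + 1 = ∑ k ∈ Finset.range m, S.growth o n (Sum.inl (w k))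
      + S.growth o n (Sum.inr (w m, b)) := by
  induction n generalizing m with
  | zero => simp
  | succ n ih =>
    rw [Function.iterate_succ_apply, ih, markedPos, Finset.sum_range_add,
      S.sum_range_imagePos hw fun c => S.growth o n (Sum.inl c), growth_succ_inr, ← add_assoc,
      hw m _ (ho b (w m))]
    congr 2
    · exact Finset.sum_congr rfl fun k _ => (S.growth_succ_inl o n (w k)).symm
    · exact Finset.sum_congr rfl fun r hr => by
        rw [hw m r ((Finset.mem_range.1 hr).trans (ho b (w m)))]

theorem growth_inr_le (ho : ∀ b a, o b a < S.len a)
    (n : ℕ) (a : A) (b : Bool) :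
    S.growth o n (Sum.inr (a, b)) ≤ S.growth o n (Sum.inl a) := by
  induction n generalizing a with
  | zero => simp
  | succ n ih =>
    rw [growth_succ_inr, growth_succ_inl]
    calc _ ≤ ∑ r ∈ Finset.range (o b a + 1), S.growth o n (Sum.inl (S.letter a r)) := by
          rw [Finset.sum_range_succ]; exact Nat.add_le_add_left (ih _) _
      _ ≤ _ := Finset.sum_le_sum_of_subset (Finset.range_mono (ho b a))

variable {w} in
theorem iterate_imagePos_le_iterate_markedPos (ho : ∀ b a, o b a < S.len a)
    (hw : S.Fixes w) (b : Bool) (n m : ℕ) :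
    (S.imagePos w)^[n] m ≤ (S.markedPos w (o b))^[n] m := by
  have h1 := S.iterate_markedPos_add_one ho hw b n m
  have h2 : 1 ≤ S.growth o n (Sum.inr (w m, b)) := by
    have : ∀ n a, 1 ≤ S.growth o n (Sum.inr (a, b)) := by
      intro n
      induction n with
      | zero => intro a; simp
      | succ n ih => intro a; rw [growth_succ_inr]; exact (ih _).trans (Nat.le_add_left _ _)
    exact this n _
  rw [S.iterate_imagePos o hw]
  omega

variable {w} in
theorem iterate_markedPos_add_one_le (ho : ∀ b a, o b a < S.len a)
    (hw : S.Fixes w) (b : Bool) (n m : ℕ) :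
    (S.markedPos w (o b))^[n] m + 1 ≤ (S.imagePos w)^[n] (m + 1) := by
  rw [S.iterate_markedPos_add_one ho hw b, S.iterate_imagePos o hw, Finset.sum_range_succ]
  exact Nat.add_le_add_left (S.growth_inr_le ho n _ b) _

theorem one_le_growth_inl (n : ℕ) (a : A) : 1 ≤ S.growth o n (Sum.inl a) := by
  induction n generalizing a with
  | zero => simp
  | succ n ih =>
    rw [growth_succ_inl]
    exact (ih _).trans (Finset.single_le_sum (f := fun r => S.growth o n (Sum.inl (S.letter a r)))
      (fun _ _ => Nat.zero_le _) (Finset.mem_range.2 (S.len_pos a)))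

theorem growth_inl_add_le {W : ℕ} (hW : ∀ a, S.len a ≤ W) (p n : ℕ) (a : A) :
    S.growth o (n + p) (Sum.inl a) ≤ W ^ p * S.growth o n (Sum.inl a) := by
  have h1 : ∀ n a, S.growth o (n + 1) (Sum.inl a) ≤ W * S.growth o n (Sum.inl a) := by
    intro n
    induction n with
    | zero => intro a; rw [growth_succ_inl]; simpa using hW a
    | succ n ih =>
      intro a
      rw [growth_succ_inl, S.growth_succ_inl o n, Finset.mul_sum]
      exact Finset.sum_le_sum fun r _ => ih _
  induction p with
  | zero => simp
  | succ p ih =>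
    rw [← add_assoc, pow_succ']
    refine (h1 _ a).trans ?_
    rw [mul_assoc]
    exact Nat.mul_le_mul_left _ ih

variable {w} in
-- A letter at position p occurs in the p-th iterated image of `w 0`, so its n-th image is no longer
-- than the (n+p)-th image of `w 0`; the p extra steps cost at most a factor W^p.
theorem exists_growth_le (ho : ∀ b a, o b a < S.len a)
    (hw : S.Fixes w) (hsurj : Function.Surjective w)
    (h2 : 2 ≤ S.len (w 0)) :
    ∃ C : ℕ, ∀ n x, S.growth o n x ≤ C * S.growth o n (Sum.inl (w 0)) := by
  obtain ⟨W, hW⟩ : ∃ W, ∀ a, S.len a ≤ W :=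
    ⟨Finset.univ.sup S.len, fun a => Finset.le_sup (Finset.mem_univ a)⟩
  choose p hp using hsurj
  have h0 : 0 < W := (S.len_pos (w 0)).trans_le (hW _)
  have key : ∀ n a, S.growth o n (Sum.inl a)
      ≤ W ^ (Finset.univ.sup p) * S.growth o n (Sum.inl (w 0)) := by
    intro n a
    calc S.growth o n (Sum.inl a) ≤ (S.imagePos w)^[n] (p a + 1) := by
          rw [S.iterate_imagePos o hw]
          have h3 := Finset.single_le_sum (f := fun k => S.growth o n (Sum.inl (w k)))
            (fun _ _ => Nat.zero_le _) (Finset.self_mem_range_succ (p a))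
          simpa [hp] using h3
      _ ≤ (S.imagePos w)^[n] ((S.imagePos w)^[p a] 1) :=
          ((S.imagePos_strictMono w).monotone.iterate n) (S.succ_le_iterate_imagePos w h2 _)
      _ = S.growth o (n + p a) (Sum.inl (w 0)) := by
          rw [← Function.iterate_add_apply, S.iterate_imagePos o hw]; simp
      _ ≤ W ^ (p a) * S.growth o n (Sum.inl (w 0)) := S.growth_inl_add_le hW _ _ _
      _ ≤ _ := Nat.mul_le_mul_right _ (Nat.pow_le_pow_right h0 (Finset.le_sup (Finset.mem_univ a)))
  refine ⟨W ^ (Finset.univ.sup p), fun n x => ?_⟩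
  rcases x with a | ⟨a, b⟩
  · exact key n a
  · exact (S.growth_inr_le ho n a b).trans (key n a)

end Growth

end LetterSubstitution

/-! ### The number field and the limits of ratios of marked positions. -/

theorem Matrix.natDegree_minpoly_le_of_eigenvector {ι : Type*} [Fintype ι] [DecidableEq ι]
    (C : Matrix ι ι ℕ) {θ : ℝ} {z : ι → ℂ} (hz : z ≠ 0)
    (h : (C.map (Nat.castRingHom ℂ)).mulVec z = (θ : ℂ) • z) :
    IsIntegral ℚ θ ∧ (minpoly ℚ θ).natDegree ≤ Fintype.card ι := by
  set p := (C.map (Nat.castRingHom ℚ)).charpoly with hp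
  have hmonic : p.Monic := Matrix.charpoly_monic _
  have hC : (C.map (Nat.castRingHom ℚ)).map (algebraMap ℚ ℂ) = C.map (Nat.castRingHom ℂ) := by
    ext i j; simp
  have hroot : Polynomial.aeval (θ : ℂ) p = 0 := by
    rw [← Polynomial.eval_map_algebraMap, hp, ← Matrix.charpoly_map, hC, Matrix.eval_charpoly]
    refine Matrix.exists_mulVec_eq_zero_iff.1 ⟨z, hz, ?_⟩
    rw [Matrix.sub_mulVec, h]
    simp [Matrix.scalar_apply, ← Matrix.smul_one_eq_diagonal, Matrix.smul_mulVec]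
  have hroot' : Polynomial.aeval θ p = 0 := by
    have : ((Polynomial.aeval θ p : ℝ) : ℂ) = 0 := by
      rw [← hroot]
      exact (Polynomial.aeval_algebraMap_apply ℂ θ p).symm
    exact_mod_cast this
  refine ⟨⟨p, hmonic, by rwa [← Polynomial.aeval_def]⟩, ?_⟩
  rw [← Matrix.charpoly_natDegree_eq_dim (C.map (Nat.castRingHom ℚ))]
  exact Polynomial.natDegree_le_of_dvd (minpoly.dvd ℚ θ hroot') hmonic.ne_zero

theorem Polynomial.eq_zero_of_tendsto_aeval_natCast {K : Type*} [Field K] [Algebra K ℝ]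
    {P : Polynomial K}
    (h : Tendsto (fun n : ℕ => Polynomial.aeval (n : ℝ) P) atTop (𝓝 0)) : P = 0 := by
  by_contra hP
  set R := P.map (algebraMap K ℝ) with hR
  have hR0 : R ≠ 0 := (Polynomial.map_ne_zero_iff (algebraMap K ℝ).injective).2 hP
  have h1 : Tendsto (fun n : ℕ => R.eval (n : ℝ)) atTop (𝓝 0) := by
    refine h.congr fun n => ?_
    rw [hR, Polynomial.eval_map_algebraMap]
  have h2 := ((Polynomial.isEquivalent_atTop_lead R).comp_tendsto
    (tendsto_natCast_atTop_atTop (R := ℝ))).tendsto_nhds h1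
  have h3 := ge_of_tendsto (b := |R.leadingCoeff|) h2.abs (by
    filter_upwards [eventually_ge_atTop 1] with n hn
    simp only [Function.comp_apply, abs_mul, abs_pow, Nat.abs_cast]
    exact le_mul_of_one_le_right (abs_nonneg _) (one_le_pow₀ (by exact_mod_cast hn)))
  rw [abs_zero, abs_nonpos_iff, Polynomial.leadingCoeff_eq_zero] at h3
  exact hR0 h3

theorem Polynomial.tendsto_aeval_natCast_div_pow {K : Type*} [Field K] [Algebra K ℝ]
    (P : Polynomial K) {q : ℝ} (hq : 1 < q) :
    Tendsto (fun n : ℕ => Polynomial.aeval (n : ℝ) P / q ^ n) atTop (𝓝 0) := by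
  have h : Tendsto (fun n : ℕ => ∑ k ∈ Finset.range (P.natDegree + 1),
      algebraMap K ℝ (P.coeff k) * ((n : ℝ) ^ k / q ^ n)) atTop (𝓝 0) := by
    rw [show (0 : ℝ) = ∑ k ∈ Finset.range (P.natDegree + 1),
      algebraMap K ℝ (P.coeff k) * 0 by simp]
    exact tendsto_finsetSum _ fun k _ =>
      (tendsto_pow_const_div_const_pow_of_one_lt k hq).const_mul _
  refine h.congr fun n => ?_
  rw [Polynomial.aeval_eq_sum_range, Finset.sum_div]
  exact Finset.sum_congr rfl fun k _ => by rw [Algebra.smul_def, mul_div_assoc]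

namespace LetterSubstitution

variable {A : Type*} (S : LetterSubstitution A) {w : ℕ → A} [Fintype A] [DecidableEq A]
  {o : Bool → A → ℕ}

/-- The marked matrix has 3|A| rows, but it is block triangular. If the unmarked part of the
eigenvector is nonzero, θ is an eigenvalue of a power of the |A|×|A| incidence matrix; the marked
block alone leaves only θ = 1. -/
theorem natDegree_minpoly_le_of_eigenvector {N : ℕ} {θ : ℝ} (hθ : 1 ≤ θ) {z : A ⊕ A × Bool → ℂ}
    (hz : z ≠ 0)
    (h : ((S.markedMatrix o ^ N).map (Nat.castRingHom ℂ)).mulVec z = (θ : ℂ) • z) :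
    IsIntegral ℚ θ ∧ (minpoly ℚ θ).natDegree ≤ Fintype.card A := by
  set Q : Matrix (A × Bool) (A × Bool) ℕ :=
    Matrix.of fun x y => if y = (S.letter x.1 (o x.2 x.1), x.2) then 1 else 0 with hQ
  have hpow : ∀ n, ∃ D, S.markedMatrix o ^ n = Matrix.fromBlocks (S.incidence ^ n) 0 D (Q ^ n) := by
    intro n
    induction n with
    | zero => exact ⟨0, by simp⟩
    | succ n ih =>
      obtain ⟨D, hD⟩ := ih
      rw [pow_succ, hD, markedMatrix, Matrix.fromBlocks_multiply]
      exact ⟨_, by simp [pow_succ, hQ]; rfl⟩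
  obtain ⟨D, hD⟩ := hpow N
  rw [hD, Matrix.fromBlocks_map, Matrix.fromBlocks_mulVec] at h
  have hinl : ((S.incidence ^ N).map (Nat.castRingHom ℂ)).mulVec (z ∘ Sum.inl)
      = (θ : ℂ) • (z ∘ Sum.inl) := by
    ext a
    have := congrFun h (Sum.inl a)
    simpa using this
  by_cases h0 : z ∘ Sum.inl = 0
  · have hinr : ((Q ^ N).map (Nat.castRingHom ℂ)).mulVec (z ∘ Sum.inr)
        = (θ : ℂ) • (z ∘ Sum.inr) := by
      ext a
      have := congrFun h (Sum.inr a)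
      simpa [h0] using this
    have hz2 : z ∘ Sum.inr ≠ 0 := by
      intro h1
      apply hz
      ext x
      rcases x with a | a
      · exact congrFun h0 a
      · exact congrFun h1 a
    -- Each row of Q has a single entry 1, so Q does not increase the sup norm.
    have hQv : ∀ v : A × Bool → ℂ, ‖(Q.map (Nat.castRingHom ℂ)).mulVec v‖ ≤ ‖v‖ := by
      intro v
      refine (pi_norm_le_iff_of_nonneg (norm_nonneg v)).2 fun x => ?_
      have : (Q.map (Nat.castRingHom ℂ)).mulVec v x = v (S.letter x.1 (o x.2 x.1), x.2) := by
        simp [Matrix.mulVec, dotProduct, hQ]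
      rw [this]
      exact norm_le_pi_norm v _
    have hQn : ∀ (n : ℕ) (v : A × Bool → ℂ),
        ‖((Q ^ n).map (Nat.castRingHom ℂ)).mulVec v‖ ≤ ‖v‖ := by
      intro n
      induction n with
      | zero => intro v; rw [Matrix.map_natCast_pow]; simp
      | succ n ih =>
        intro v
        rw [Matrix.map_natCast_pow, pow_succ, ← Matrix.mulVec_mulVec, ← Matrix.map_natCast_pow]
        exact (ih _).trans (hQv v)
    have h1 := hQn N (z ∘ Sum.inr)
    rw [hinr, norm_smul, Complex.norm_real, Real.norm_of_nonneg (by linarith)] at h1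
    have h2 : 0 < ‖z ∘ Sum.inr‖ := norm_pos_iff.2 hz2
    have h3 : θ = 1 := le_antisymm (by nlinarith) hθ
    have : Nonempty A := by
      by_contra hA
      rw [not_nonempty_iff] at hA
      exact hz2 (Subsingleton.elim _ _)
    rw [h3]
    refine ⟨isIntegral_one, ?_⟩
    rw [minpoly.one, ← Polynomial.C_1, Polynomial.natDegree_X_sub_C]
    exact Fintype.card_pos
  · exact Matrix.natDegree_minpoly_le_of_eigenvector _ h0 hinl

theorem growth_inl_of_uniform {M : ℕ} (hM : ∀ a, S.len a = M) (n : ℕ) (a : A) :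
    S.growth o n (Sum.inl a) = M ^ n := by
  induction n generalizing a with
  | zero => simp
  | succ n ih => rw [growth_succ_inl]; simp [ih, hM, pow_succ']

open IntermediateField in
/-- The quotients of the iterates of two marked positions converge, along an arithmetic
progression, to elements of a fixed number field of degree at most the number of letters. -/
theorem exists_field_tendsto_div (ho : ∀ b a, o b a < S.len a) (hw : S.Fixes w)
    (hsurj : Function.Surjective w) (h2 : 2 ≤ S.len (w 0)) :
    ∃ N : ℕ, 0 < N ∧ ∃ K : IntermediateField ℚ ℝ, FiniteDimensional ℚ K ∧
      Module.finrank ℚ K ≤ Fintype.card A ∧ ((∃ M, ∀ a, S.len a = M) → K = ⊥) ∧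
      ∀ i j, 1 ≤ i → ∃ v ∈ K, Tendsto (fun n : ℕ =>
        (((S.markedPos w (o false))^[N * n] j + 1 : ℕ) : ℝ)
          / (((S.markedPos w (o true))^[N * n] i + 1 : ℕ) : ℝ)) atTop (𝓝 v) := by
  obtain ⟨N, hN, θ, hθ, ⟨z, hz0, hz⟩, P, ⟨x₀, hx₀⟩, hP⟩ :=
    Matrix.exists_polynomial_asymptotics (S.markedMatrix o) (Sum.inl (w 0))
      (fun n => S.one_le_growth_inl n (w 0))
  change ∀ x, Tendsto (fun n : ℕ => ((S.growth o (N * n) x : ℕ) : ℝ) / θ ^ n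
    - Polynomial.aeval (n : ℝ) (P x)) atTop (𝓝 0) at hP
  obtain ⟨hint, hdeg⟩ := S.natDegree_minpoly_le_of_eigenvector hθ hz0 hz
  obtain ⟨C, hC⟩ := S.exists_growth_le ho hw hsurj h2
  have hθ0 : 0 < θ := by linarith
  let Pos : Bool → ℕ → Polynomial ℚ⟮θ⟯ := fun b i =>
    ∑ k ∈ Finset.range i, P (Sum.inl (w k)) + P (Sum.inr (w i, b))
  have hPos : ∀ b i, Tendsto (fun n : ℕ =>
      (((S.markedPos w (o b))^[N * n] i + 1 : ℕ) : ℝ) / θ ^ n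
        - Polynomial.aeval (n : ℝ) (Pos b i)) atTop (𝓝 0) := by
    intro b i
    have h3 : Tendsto (fun n : ℕ => ∑ k ∈ Finset.range i,
        (((S.growth o (N * n) (Sum.inl (w k)) : ℕ) : ℝ) / θ ^ n
          - Polynomial.aeval (n : ℝ) (P (Sum.inl (w k))))
        + (((S.growth o (N * n) (Sum.inr (w i, b)) : ℕ) : ℝ) / θ ^ n
          - Polynomial.aeval (n : ℝ) (P (Sum.inr (w i, b))))) atTop (𝓝 0) := by
      have := (tendsto_finsetSum (Finset.range i) fun k _ => hP (Sum.inl (w k))).add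
        (hP (Sum.inr (w i, b)))
      simpa using this
    refine h3.congr fun n => ?_
    rw [S.iterate_markedPos_add_one ho hw]
    simp only [Pos]
    push_cast
    rw [map_add, map_sum, Finset.sum_sub_distrib, add_div, Finset.sum_div]
    ring
  have hstart : ∀ n i, 1 ≤ i →
      S.growth o n (Sum.inl (w 0)) ≤ (S.markedPos w (o true))^[n] i + 1 := by
    intro n i hi
    rw [S.iterate_markedPos_add_one ho hw]
    refine le_trans ?_ (Nat.le_add_right _ _)
    exact Finset.single_le_sum (f := fun k => S.growth o n (Sum.inl (w k)))
      (fun _ _ => Nat.zero_le _) (Finset.mem_range.2 hi)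
  have : FiniteDimensional ℚ ℚ⟮θ⟯ := adjoin.finiteDimensional hint
  refine ⟨N, hN, ℚ⟮θ⟯, this, by rwa [adjoin.finrank hint], ?_, fun i j hi => ?_⟩
  · rintro ⟨M, hM⟩
    have hX0 : ∀ n, S.growth o n (Sum.inl (w 0)) = M ^ n := fun n => S.growth_inl_of_uniform hM n _
    have hM0 : 0 < M := hM (w 0) ▸ S.len_pos _
    have hM0' : (0 : ℝ) < M := by exact_mod_cast hM0
    -- A smaller θ would need a polynomial to follow an exponential; a larger one would make all
    -- entries o(θ^n), hence all polynomials zero.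
    have hθM : θ = (M : ℝ) ^ N := by
      rcases lt_trichotomy θ ((M : ℝ) ^ N) with hlt | heq | hgt
      · exfalso
        set q := (M : ℝ) ^ N / θ with hq
        have hq1 : 1 < q := (one_lt_div hθ0).2 hlt
        have h4 : Tendsto (fun n : ℕ => Polynomial.aeval (n : ℝ) (P (Sum.inl (w 0))) / q ^ n)
            atTop (𝓝 0) := by
          exact Polynomial.tendsto_aeval_natCast_div_pow _ hq1
        have h5 : Tendsto (fun n : ℕ => (((S.growth o (N * n) (Sum.inl (w 0)) : ℕ) : ℝ) / θ ^ n
            - Polynomial.aeval (n : ℝ) (P (Sum.inl (w 0)))) / q ^ n) atTop (𝓝 0) := by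
          refine squeeze_zero_norm (fun n => ?_)
            (tendsto_zero_iff_norm_tendsto_zero.1 (hP (Sum.inl (w 0))))
          rw [norm_div]
          refine div_le_self (norm_nonneg _) ?_
          rw [norm_pow, Real.norm_of_nonneg (by linarith)]
          exact one_le_pow₀ hq1.le
        have h6 := h4.add h5
        rw [add_zero] at h6
        refine absurd (tendsto_nhds_unique h6 (tendsto_const_nhds (x := (1 : ℝ)).congr fun n => ?_))
          zero_ne_one
        rw [hX0]
        have e1 : ((M ^ (N * n) : ℕ) : ℝ) / θ ^ n = q ^ n := by
          rw [hq, div_pow, pow_mul]; push_cast; rfl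
        rw [e1]
        have : q ^ n ≠ 0 := by positivity
        field_simp
        ring
      · exact heq
      · exfalso
        refine hx₀ (Polynomial.eq_zero_of_tendsto_aeval_natCast ?_)
        have h7 : Tendsto (fun n : ℕ => ((S.growth o (N * n) x₀ : ℕ) : ℝ) / θ ^ n) atTop (𝓝 0) := by
          have h8 : Tendsto (fun n : ℕ => (C : ℝ) * ((M : ℝ) ^ N / θ) ^ n) atTop (𝓝 0) := by
            simpa using (tendsto_pow_atTop_nhds_zero_of_lt_one (by positivity)
              ((div_lt_one hθ0).2 hgt)).const_mul (C : ℝ)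
          refine squeeze_zero (fun n => by positivity) (fun n => ?_) h8
          rw [div_pow, ← mul_div_assoc]
          refine div_le_div_of_nonneg_right ?_ (by positivity)
          rw [← pow_mul]
          have := hC (N * n) x₀
          rw [hX0] at this
          exact_mod_cast this
        simpa using h7.sub (hP x₀)
    rw [hθM]
    refine adjoin_simple_eq_bot_iff.2 ?_
    exact pow_mem (IntermediateField.natCast_mem _ M) N
  -- As i ≥ 1, the denominator is at least the growth of `w 0`, which dominates all entries up to
  -- the factor C; a zero polynomial here would force `P x₀` to vanish.
  · have hQ : Pos true i ≠ 0 := by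
      intro hQ0
      refine hx₀ (Polynomial.eq_zero_of_tendsto_aeval_natCast ?_)
      have h3 := hPos true i
      simp only [hQ0, map_zero, sub_zero] at h3
      have h7 : Tendsto (fun n : ℕ => ((S.growth o (N * n) x₀ : ℕ) : ℝ) / θ ^ n) atTop (𝓝 0) := by
        refine squeeze_zero (fun n => by positivity) (fun n => ?_)
          (by simpa using h3.const_mul (C : ℝ))
        rw [← mul_div_assoc]
        refine div_le_div_of_nonneg_right ?_ (by positivity)
        exact_mod_cast (hC (N * n) x₀).trans (Nat.mul_le_mul_left C (hstart (N * n) i hi))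
      simpa using h7.sub (hP x₀)
    obtain ⟨v, hv⟩ := Polynomial.tendsto_div_of_sub_tendsto_zero hQ (hPos false j) (hPos true i)
      (M := ((j + 1) * C : ℕ)) (fun n => by
        rw [abs_of_nonneg (by positivity), abs_of_nonneg (by positivity), ← mul_div_assoc]
        refine div_le_div_of_nonneg_right ?_ (by positivity)
        have h8 : (S.markedPos w (o false))^[N * n] j + 1
            ≤ (j + 1) * C * ((S.markedPos w (o true))^[N * n] i + 1) := by
          refine (S.iterate_markedPos_add_one_le ho hw false (N * n) j).trans ?_
          rw [S.iterate_imagePos o hw]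
          refine (Finset.sum_le_card_nsmul _ _ (C * ((S.markedPos w (o true))^[N * n] i + 1))
            fun k _ => (hC _ _).trans (Nat.mul_le_mul_left C (hstart (N * n) i hi))).trans ?_
          rw [Finset.card_range, smul_eq_mul, mul_assoc]
        exact_mod_cast h8)
    refine ⟨algebraMap ℚ⟮θ⟯ ℝ v, v.2, hv.congr fun n => ?_⟩
    rw [div_div_div_cancel_right₀ (by positivity)]

end LetterSubstitution

/-! ### Gaps, their descent, and the limits of their ratios. -/

/-- `s < t` are consecutive positions of letters of `w` outside `Δ`. -/
def MorphicWord.IsGap {A : Type*} (w : ℕ → A) (Δ : Set A) (s t : ℕ) : Prop :=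
  s < t ∧ w s ∉ Δ ∧ w t ∉ Δ ∧ ∀ n, s < n → n < t → w n ∈ Δ

namespace LetterSubstitution

open MorphicWord

variable {A : Type*} (S : LetterSubstitution A) {w : ℕ → A}

/-- The offset of the first (`false`) or last (`true`) letter outside `Δ` in the image of `a`. -/
noncomputable def mark (Δ : Set A) : Bool → A → ℕ
  | false, a => sInf {r | r < S.len a ∧ S.letter a r ∉ Δ}
  | true, a => sSup {r | r < S.len a ∧ S.letter a r ∉ Δ}

theorem bddAbove_marks (Δ : Set A) (a : A) : BddAbove {r | r < S.len a ∧ S.letter a r ∉ Δ} :=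
  ⟨S.len a, fun _ hr => hr.1.le⟩

theorem mark_mem {Δ : Set A} {a : A} {r : ℕ} (hr : r < S.len a) (h : S.letter a r ∉ Δ) (b : Bool) :
    S.mark Δ b a ∈ {r | r < S.len a ∧ S.letter a r ∉ Δ} := by
  cases b
  · exact Nat.sInf_mem ⟨r, hr, h⟩
  · exact Nat.sSup_mem ⟨r, hr, h⟩ (S.bddAbove_marks Δ a)

theorem mark_lt (Δ : Set A) (b : Bool) (a : A) : S.mark Δ b a < S.len a := by
  by_cases h : ∃ r, r < S.len a ∧ S.letter a r ∉ Δ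
  · obtain ⟨r, hr, h⟩ := h
    exact (S.mark_mem hr h b).1
  · have h0 : {r | r < S.len a ∧ S.letter a r ∉ Δ} = ∅ :=
      Set.eq_empty_iff_forall_notMem.2 fun r hr => h ⟨r, hr⟩
    have := S.len_pos a
    cases b
    · simpa [mark, h0] using this
    · simpa [mark, h0] using this

theorem mark_false_le {Δ : Set A} {a : A} {r : ℕ} (hr : r < S.len a) (h : S.letter a r ∉ Δ) :
    S.mark Δ false a ≤ r := Nat.sInf_le ⟨hr, h⟩

theorem le_mark_true {Δ : Set A} {a : A} {r : ℕ} (hr : r < S.len a) (h : S.letter a r ∉ Δ) :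
    r ≤ S.mark Δ true a := le_csSup (S.bddAbove_marks Δ a) ⟨hr, h⟩

theorem exists_eq_imagePos_add (w : ℕ → A) (p : ℕ) :
    ∃ m r, r < S.len (w m) ∧ p = S.imagePos w m + r := by
  induction p with
  | zero => exact ⟨0, 0, S.len_pos _, by simp⟩
  | succ p ih =>
    obtain ⟨m, r, hr, rfl⟩ := ih
    rcases Nat.lt_or_ge (r + 1) (S.len (w m)) with h | h
    · exact ⟨m, r + 1, h, by omega⟩
    · exact ⟨m + 1, 0, S.len_pos _, by rw [imagePos_succ]; omega⟩

theorem imagePos_add_lt_of_lt {m m' r : ℕ} (h : m < m') (hr : r < S.len (w m)) :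
    S.imagePos w m + r < S.imagePos w m' := by
  have := (S.imagePos_strictMono w).monotone (Nat.succ_le_of_lt h)
  rw [Nat.succ_eq_add_one, imagePos_succ] at this
  omega

theorem lt_of_imagePos_add_eq (h2 : 2 ≤ S.len (w 0)) {m r p : ℕ} (hp : 0 < p)
    (h : p = S.imagePos w m + r) : m < p := by
  cases m with
  | zero => exact hp
  | succ m => have := S.add_two_le_imagePos_succ w h2 m; omega

/-- A gap of `Δ` is short or comes from a gap of the preimage of `Δ`. -/
theorem isGap_cases (hw : S.Fixes w) {W : ℕ} (hW : ∀ a, S.len a ≤ W) {Γ Δ : Set A}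
    (hΓ : ∀ a, a ∈ Γ ↔ ∀ r < S.len a, S.letter a r ∈ Δ) {s t : ℕ} (h : IsGap w Δ s t) :
    t ≤ s + W ∨ ∃ m₁ m₂, IsGap w Γ m₁ m₂ ∧ s = S.markedPos w (S.mark Δ true) m₁ ∧
      t = S.markedPos w (S.mark Δ false) m₂ := by
  obtain ⟨hst, hs, ht, hbetween⟩ := h
  obtain ⟨m₁, r₁, hr₁, rfl⟩ := S.exists_eq_imagePos_add w s
  obtain ⟨m₂, r₂, hr₂, rfl⟩ := S.exists_eq_imagePos_add w t
  rcases lt_trichotomy m₁ m₂ with hlt | rfl | hgt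
  · right
    have hs' : S.letter (w m₁) r₁ ∉ Δ := by rwa [← hw m₁ r₁ hr₁]
    have ht' : S.letter (w m₂) r₂ ∉ Δ := by rwa [← hw m₂ r₂ hr₂]
    have hΓ' : ∀ a r, r < S.len a → S.letter a r ∉ Δ → a ∉ Γ := fun a r hr hra ha =>
      hra ((hΓ a).1 ha r hr)
    refine ⟨m₁, m₂, ⟨hlt, hΓ' _ _ hr₁ hs', hΓ' _ _ hr₂ ht', fun m h1 h2 => ?_⟩, ?_, ?_⟩
    · refine (hΓ _).2 fun r hr => ?_
      rw [← hw m r hr]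
      refine hbetween _ ?_ ?_
      · have := S.imagePos_add_lt_of_lt h1 hr₁; omega
      · have := S.imagePos_add_lt_of_lt h2 hr; omega
    -- A later letter outside Δ in the same image would lie strictly between s and t; symmetrically
    -- for the first such letter at t.
    · have hle := S.le_mark_true hr₁ hs'
      have hm := S.mark_mem hr₁ hs' true
      rcases hle.lt_or_eq with h1 | h1
      · exfalso
        apply hm.2
        rw [← hw _ _ hm.1]
        have := S.imagePos_add_lt_of_lt hlt hm.1
        exact hbetween _ (by omega) (by omega)
      · rw [markedPos, ← h1]
    · have hle := S.mark_false_le hr₂ ht'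
      have hm := S.mark_mem hr₂ ht' false
      rcases hle.lt_or_eq with h1 | h1
      · exfalso
        apply hm.2
        rw [← hw _ _ hm.1]
        have := S.imagePos_add_lt_of_lt hlt hr₁
        exact hbetween _ (by omega) (by omega)
      · rw [markedPos, h1]
  · left
    have := hW (w m₁)
    omega
  · have := S.imagePos_add_lt_of_lt hgt hr₂
    omega

/-- All gaps of an invariant set of letters descend from short gaps. -/
theorem exists_short_isGap (hw : S.Fixes w) (h2 : 2 ≤ S.len (w 0)) {W : ℕ}
    (hW : ∀ a, S.len a ≤ W) {Γ : Set A} (hΓ : ∀ a, a ∈ Γ ↔ ∀ r < S.len a, S.letter a r ∈ Γ)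
    (t : ℕ) : ∀ s, IsGap w Γ s t → ∃ s₀ t₀ n, t₀ ≤ s₀ + W ∧
      s = (S.markedPos w (S.mark Γ true))^[n] s₀ ∧
      t = (S.markedPos w (S.mark Γ false))^[n] t₀ := by
  induction t using Nat.strong_induction_on with
  | _ t ih =>
    intro s h
    rcases S.isGap_cases hw hW hΓ h with hshort | ⟨m₁, m₂, hm, hs, ht⟩
    · exact ⟨s, t, 0, hshort, rfl, rfl⟩
    · have hlt : m₂ < t := S.lt_of_imagePos_add_eq h2 (by have := h.1; omega) ht
      obtain ⟨s₀, t₀, n, h3, h4, h5⟩ := ih m₂ hlt m₁ hm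
      exact ⟨s₀, t₀, n + 1, h3, by rw [Function.iterate_succ_apply', ← h4, hs],
        by rw [Function.iterate_succ_apply', ← h5, ht]⟩

/-- Position 0 could only arise if the image of `w 0` had no letter outside Γ after its first. Then,
tracing positions back through images, all letters but `w 0` would lie in Γ. -/
theorem one_le_markedPos_true (hw : S.Fixes w) (h2 : 2 ≤ S.len (w 0)) {Γ : Set A}
    (hΓ : ∀ a, a ∈ Γ ↔ ∀ r < S.len a, S.letter a r ∈ Γ) (hinf : {n | w n ∉ Γ}.Infinite) (s : ℕ) :
    1 ≤ S.markedPos w (S.mark Γ true) s := by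
  cases s with
  | succ s =>
    have := S.add_two_le_imagePos_succ w h2 s
    rw [markedPos]; omega
  | zero =>
    by_contra! h0
    have h0' : S.mark Γ true (w 0) = 0 := by rw [markedPos] at h0; omega
    have hall : ∀ t, 0 < t → w t ∈ Γ := by
      intro t
      induction t using Nat.strong_induction_on with
      | _ t ih =>
        intro ht
        obtain ⟨m, r, hr, hmr⟩ := S.exists_eq_imagePos_add w t
        have hlt := S.lt_of_imagePos_add_eq h2 ht hmr
        rw [hmr, hw m r hr]
        rcases Nat.eq_zero_or_pos m with rfl | hm
        · by_contra hcon
          have := S.le_mark_true hr hcon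
          rw [imagePos_zero] at hmr
          omega
        · exact (hΓ _).1 (ih m hlt hm) r hr
    refine hinf ((Set.finite_singleton 0).subset fun n hn => ?_)
    by_contra hn0
    exact hn (hall n (Nat.pos_of_ne_zero hn0))

section Recurrence

variable [Fintype A] [DecidableEq A]

/-- A letter either recurs, and is then seen Z times early, or eventually disappears; finitely many
letters share one threshold. -/
theorem _root_.MorphicWord.exists_forall_le_card_filter (w : ℕ → A) (Z : ℕ) :
    ∃ s₀, ∀ s, s₀ ≤ s → ∀ p, s ≤ p →
      Z ≤ ((Finset.range s).filter (w · = w p)).card := by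
  have h : ∀ a, ∃ s₀, ∀ s, s₀ ≤ s → ∀ p, s ≤ p → w p = a →
      Z ≤ ((Finset.range s).filter (w · = a)).card := by
    intro a
    by_cases hinf : {k | w k = a}.Infinite
    · obtain ⟨F, hF, hcard⟩ := hinf.exists_subset_card_eq Z
      refine ⟨F.sup id + 1, fun s hs p _ _ => ?_⟩
      rw [← hcard]
      refine Finset.card_le_card fun k hk => ?_
      have h1 : k ≤ F.sup id := Finset.le_sup (f := id) hk
      exact Finset.mem_filter.2 ⟨Finset.mem_range.2 (by omega), hF hk⟩
    · rw [Set.not_infinite] at hinf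
      obtain ⟨b, hb⟩ := hinf.bddAbove
      refine ⟨b + 1, fun s hs p hp hpa => ?_⟩
      have : p ≤ b := hb hpa
      omega
  choose s₀ hs₀ using h
  exact ⟨Finset.univ.sup s₀, fun s hs p hp =>
    hs₀ (w p) s ((Finset.le_sup (Finset.mem_univ _)).trans hs) p hp rfl⟩

/-- Far to the right, all descendants of short factors have quotients close to `1`. -/
theorem exists_forall_markedPos_le (hw : S.Fixes w) {o : Bool → A → ℕ}
    (ho : ∀ b a, o b a < S.len a) (W : ℕ) {ε : ℝ} (hε : 0 < ε) :
    ∃ s₁, ∀ s₀ t₀, s₁ ≤ s₀ → t₀ ≤ s₀ + W → ∀ n,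
      (((S.markedPos w (o false))^[n] t₀ + 1 : ℕ) : ℝ)
        ≤ (1 + ε) * (((S.markedPos w (o true))^[n] s₀ + 1 : ℕ) : ℝ) := by
  -- Each of the W + 1 letters following s₀ has Z copies before s₀, so their images add at most the
  -- fraction (W + 1)/Z < ε to the prefix.
  obtain ⟨Z, hZ⟩ := exists_nat_gt ((W + 1 : ℕ) / ε)
  have hZ0 : (0 : ℝ) < Z := lt_of_le_of_lt (by positivity) hZ
  obtain ⟨s₁, hs₁⟩ := exists_forall_le_card_filter w Z
  refine ⟨s₁, fun s₀ t₀ hs₀ ht₀ n => ?_⟩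
  have hX : ∀ r, Z * S.growth o n (Sum.inl (w (s₀ + r))) ≤ (S.imagePos w)^[n] s₀ := by
    intro r
    rw [S.iterate_imagePos o hw]
    calc Z * S.growth o n (Sum.inl (w (s₀ + r)))
        ≤ ∑ k ∈ (Finset.range s₀).filter (w · = w (s₀ + r)), S.growth o n (Sum.inl (w k)) := by
          rw [Finset.sum_congr rfl fun k hk => by rw [(Finset.mem_filter.1 hk).2],
            Finset.sum_const, smul_eq_mul]
          exact Nat.mul_le_mul_right _ (hs₁ s₀ hs₀ _ (Nat.le_add_right _ _))
      _ ≤ _ := Finset.sum_le_sum_of_subset (Finset.filter_subset _ _)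
  have h1 : (S.markedPos w (o false))^[n] t₀ + 1 ≤ (S.imagePos w)^[n] (s₀ + (W + 1)) :=
    (S.iterate_markedPos_add_one_le ho hw false n t₀).trans
      (((S.imagePos_strictMono w).monotone.iterate n) (by omega))
  have h3 : Z * (S.imagePos w)^[n] (s₀ + (W + 1)) ≤ (Z + (W + 1)) * (S.imagePos w)^[n] s₀ := by
    conv_lhs => rw [S.iterate_imagePos o hw, Finset.sum_range_add, ← S.iterate_imagePos o hw]
    rw [mul_add, add_mul]
    refine Nat.add_le_add_left ?_ _
    rw [Finset.mul_sum]
    refine (Finset.sum_le_card_nsmul _ _ _ fun r _ => hX r).trans ?_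
    rw [Finset.card_range, smul_eq_mul]
  have h4 := S.iterate_imagePos_le_iterate_markedPos ho hw true n s₀
  have h5 : (Z : ℝ) * (((S.markedPos w (o false))^[n] t₀ + 1 : ℕ) : ℝ)
      ≤ (Z + (W + 1 : ℕ)) * (((S.markedPos w (o true))^[n] s₀ + 1 : ℕ) : ℝ) := by
    exact_mod_cast (Nat.mul_le_mul_left Z h1).trans (h3.trans (Nat.mul_le_mul_left _
      (h4.trans (Nat.le_succ _))))
  have h6 : ((W + 1 : ℕ) : ℝ) ≤ Z * ε := ((div_lt_iff₀ hε).1 hZ).le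
  refine le_of_mul_le_mul_left (h5.trans ?_) hZ0
  rw [← mul_assoc]
  refine mul_le_mul_of_nonneg_right ?_ (by positivity)
  linarith

/-- The possible limits of quotients of consecutive positions outside `Δ` lie, apart from `1`, in a
fixed number field, and only finitely many of them are not close to `1`. -/
theorem exists_field_isGap_ratio (hw : S.Fixes w) (hsurj : Function.Surjective w)
    (h2 : 2 ≤ S.len (w 0)) {Γ Δ : Set A} (hΓ : ∀ a, a ∈ Γ ↔ ∀ r < S.len a, S.letter a r ∈ Γ)
    (hΔ : ∀ a, a ∈ Γ ↔ ∀ r < S.len a, S.letter a r ∈ Δ) (hinf : {n | w n ∉ Γ}.Infinite) :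
    ∃ K : IntermediateField ℚ ℝ, FiniteDimensional ℚ K ∧
      Module.finrank ℚ K ≤ Fintype.card A ∧ ((∃ M, ∀ a, S.len a = M) → K = ⊥) ∧
      ∀ ε : ℝ, 0 < ε → ∃ T : Set ℝ, T.Finite ∧ T ⊆ K ∧ ∀ η : ℝ, 0 < η → ∃ s₁ : ℕ, ∀ s t,
        IsGap w Δ s t → s₁ ≤ s → ((t : ℝ) - 1) / (s + 1) ≤ 1 + ε ∨
          ∃ v ∈ T, |((t : ℝ) - 1) / (s + 1) - v| < η := by
  obtain ⟨W, hW⟩ : ∃ W, ∀ a, S.len a ≤ W :=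
    ⟨Finset.univ.sup S.len, fun a => Finset.le_sup (Finset.mem_univ a)⟩
  obtain ⟨N, hN, K, hK, hKA, hKu, hlim⟩ :=
    S.exists_field_tendsto_div (o := S.mark Γ) (S.mark_lt Γ) hw hsurj h2
  refine ⟨K, hK, hKA, hKu, fun ε hε => ?_⟩
  set R := S.markedPos w (S.mark Γ true) with hR
  set F := S.markedPos w (S.mark Γ false) with hF
  obtain ⟨S₀, hS₀⟩ := S.exists_forall_markedPos_le hw (S.mark_lt Γ) W (half_pos hε)
  have hlim' : ∀ i j, ∃ v ∈ K, 1 ≤ i → Tendsto (fun n : ℕ =>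
      ((F^[N * n] j + 1 : ℕ) : ℝ) / ((R^[N * n] i + 1 : ℕ) : ℝ)) atTop (𝓝 v) := by
    intro i j
    by_cases hi : 1 ≤ i
    · obtain ⟨v, hv, h⟩ := hlim i j hi
      exact ⟨v, hv, fun _ => h⟩
    · exact ⟨0, K.zero_mem, fun h => absurd h hi⟩
  choose v hvK hv using hlim'
  -- The near short gaps together with a number of initial steps mod N: each triple determines one
  -- limit.
  let I : Finset (ℕ × ℕ × ℕ) :=
    Finset.range S₀ ×ˢ Finset.range (S₀ + W + 1) ×ˢ Finset.range (N + 1)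
  let V : ℕ × ℕ × ℕ → ℝ := fun x => v (R^[x.2.2] x.1) (F^[x.2.2] x.2.1)
  have hTfin : (V '' (I : Set (ℕ × ℕ × ℕ))).Finite := I.finite_toSet.image V
  refine ⟨V '' (I : Set (ℕ × ℕ × ℕ)), hTfin, ?_, fun η hη => ?_⟩
  · rintro _ ⟨x, -, rfl⟩
    exact hvK _ _
  obtain ⟨b, hb⟩ := hTfin.bddAbove
  have hnear : ∃ s₁ : ℕ, ∀ s₀ t₀ n, t₀ ≤ s₀ + W → s₁ ≤ R^[n] s₀ →
      ((F^[n] t₀ + 1 : ℕ) : ℝ) / ((R^[n] s₀ + 1 : ℕ) : ℝ) ≤ 1 + ε / 2 ∨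
      ∃ u ∈ V '' (I : Set (ℕ × ℕ × ℕ)),
        |((F^[n] t₀ + 1 : ℕ) : ℝ) / ((R^[n] s₀ + 1 : ℕ) : ℝ) - u| < η / 2 := by
    have hn₀ : ∀ x : ℕ × ℕ × ℕ, ∃ n₀ : ℕ, 1 ≤ R^[x.2.2] x.1 → ∀ n, n₀ ≤ n →
        |((F^[N * n] (F^[x.2.2] x.2.1) + 1 : ℕ) : ℝ)
          / ((R^[N * n] (R^[x.2.2] x.1) + 1 : ℕ) : ℝ) - V x| < η / 2 := by
      intro x
      by_cases hx : 1 ≤ R^[x.2.2] x.1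
      · obtain ⟨n₀, h⟩ := (Metric.tendsto_atTop.1 (hv _ (F^[x.2.2] x.2.1) hx)) (η / 2) (half_pos hη)
        exact ⟨n₀, fun _ n hn => by have := h n hn; rwa [Real.dist_eq] at this⟩
      · exact ⟨0, fun h => absurd h hx⟩
    choose n₀ hn₀ using hn₀
    set n₁ := I.sup n₀ with hn₁
    let J : Finset (ℕ × ℕ) := Finset.range S₀ ×ˢ Finset.range (N * n₁ + 1)
    refine ⟨J.sup (fun x => R^[x.2] x.1) + 1, fun s₀ t₀ n ht₀ hn => ?_⟩
    rcases Nat.lt_or_ge s₀ S₀ with hlt | hge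
    · right
      have hnbig : N * n₁ + 1 ≤ n := by
        by_contra! hcon
        have hmem : (s₀, n) ∈ J :=
          Finset.mem_product.2 ⟨Finset.mem_range.2 hlt, Finset.mem_range.2 hcon⟩
        have := Finset.le_sup (f := fun x : ℕ × ℕ => R^[x.2] x.1) hmem
        simp only at this
        omega
      -- The residue is taken in 1, …, N rather than 0, …, N - 1, so that at least one step has been
      -- made and the start position is positive.
      set q := (n - 1) % N + 1 with hq
      set n' := (n - 1) / N with hn'
      have hnq : n = N * n' + q := by
        have : N * n' + (n - 1) % N = n - 1 := Nat.div_add_mod (n - 1) N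
        omega
      have hqN : q ≤ N := Nat.mod_lt _ hN
      have hn'n : n₁ ≤ n' := (Nat.le_div_iff_mul_le hN).2 (by rw [mul_comm]; omega)
      have hxI : (s₀, t₀, q) ∈ I :=
        Finset.mem_product.2 ⟨Finset.mem_range.2 hlt, Finset.mem_product.2
          ⟨Finset.mem_range.2 (by simp only; omega), Finset.mem_range.2 (by simp only; omega)⟩⟩
      have hR1 : 1 ≤ R^[q] s₀ := by
        rw [hq, Function.iterate_succ_apply']
        exact S.one_le_markedPos_true hw h2 hΓ hinf _
      refine ⟨V (s₀, t₀, q), ⟨_, hxI, rfl⟩, ?_⟩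
      have := hn₀ (s₀, t₀, q) hR1 n' ((Finset.le_sup hxI).trans hn'n)
      rwa [← Function.iterate_add_apply, ← Function.iterate_add_apply, ← hnq] at this
    · left
      rw [div_le_iff₀ (by positivity)]
      exact hS₀ s₀ t₀ hge ht₀ n
  obtain ⟨s₁, hs₁⟩ := hnear
  set B := max (1 + ε / 2) (b + η / 2) with hB
  have hB0 : 0 ≤ B := le_trans (by positivity) (le_max_left _ _)
  -- Replacing the Δ-marks of the last step by Γ-marks moves both endpoints by at most W, and
  -- passing from t - 1 to t + 1 costs 2; with B bounding the ratio, the total error is at most (W +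
  -- 2 + B·W)/(s + 1).
  obtain ⟨s₂, hs₂⟩ := exists_nat_gt ((W + 2 + B * W) / min (ε / 2) (η / 2))
  have hmin : 0 < min (ε / 2) (η / 2) := lt_min (half_pos hε) (half_pos hη)
  refine ⟨s₁ + s₂ + W, fun s t hgap hs => ?_⟩
  have hsp : (0 : ℝ) < s + 1 := by positivity
  have hbig : (W + 2 + B * W) / (s + 1) < min (ε / 2) (η / 2) := by
    rw [div_lt_iff₀ hsp]
    rw [div_lt_iff₀ hmin] at hs₂
    have : (s₂ : ℝ) ≤ s + 1 := by exact_mod_cast (by omega : s₂ ≤ s + 1)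
    nlinarith
  rcases S.isGap_cases hw hW hΔ hgap with hshort | ⟨m₁, m₂, hm, hms, hmt⟩
  · left
    have h3 : ((t : ℝ) - 1) ≤ s + 1 + W := by
      have : (t : ℝ) ≤ s + W := by exact_mod_cast hshort
      linarith
    have h4 : (W : ℝ) / (s + 1) ≤ (W + 2 + B * W) / (s + 1) := by
      apply div_le_div_of_nonneg_right _ hsp.le
      have : 0 ≤ B * W := by positivity
      linarith
    calc ((t : ℝ) - 1) / (s + 1) ≤ (s + 1 + W) / (s + 1) := by gcongr
      _ = 1 + W / (s + 1) := by field_simp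
      _ ≤ 1 + ε := by linarith [min_le_left (ε / 2) (η / 2)]
  · obtain ⟨s₀, t₀, n, ht₀, hn1, hn2⟩ := S.exists_short_isGap hw h2 hW hΓ m₂ m₁ hm
    set s' := R^[n + 1] s₀ with hs'
    set t' := F^[n + 1] t₀ with ht'
    have es' : s' = S.imagePos w m₁ + S.mark Γ true (w m₁) := by
      rw [hs', Function.iterate_succ_apply', ← hn1]; rfl
    have et' : t' = S.imagePos w m₂ + S.mark Γ false (w m₂) := by
      rw [ht', Function.iterate_succ_apply', ← hn2]; rfl
    rw [markedPos] at hms hmt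
    have b1 := (S.mark_lt Γ true (w m₁)).trans_le (hW _)
    have b2 := (S.mark_lt Γ false (w m₂)).trans_le (hW _)
    have b3 := (S.mark_lt Δ true (w m₁)).trans_le (hW _)
    have b4 := (S.mark_lt Δ false (w m₂)).trans_le (hW _)
    have c1 : (s' : ℝ) ≤ s + W := by exact_mod_cast (by omega : s' ≤ s + W)
    have c2 : (s : ℝ) ≤ s' + W := by exact_mod_cast (by omega : s ≤ s' + W)
    have c3 : (t' : ℝ) ≤ t + W := by exact_mod_cast (by omega : t' ≤ t + W)
    have c4 : (t : ℝ) ≤ t' + W := by exact_mod_cast (by omega : t ≤ t' + W)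
    have hmain := hs₁ s₀ t₀ (n + 1) ht₀ (by omega)
    set r := ((t' + 1 : ℕ) : ℝ) / ((s' + 1 : ℕ) : ℝ) with hr
    have hrs : r * (s' + 1) = t' + 1 := by rw [hr]; push_cast; field_simp
    have hr0 : 0 ≤ r := by positivity
    have hrB : r ≤ B := by
      rcases hmain with h | ⟨u, hu, h⟩
      · exact h.trans (le_max_left _ _)
      · refine le_trans ?_ (le_max_right _ _)
        have := (abs_lt.1 h).2
        linarith [hb hu]
    have hdiff : |((t : ℝ) - 1) / (s + 1) - r| < min (ε / 2) (η / 2) := by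
      refine lt_of_le_of_lt ?_ hbig
      have e1 : ((t : ℝ) - 1) / (s + 1) - r = ((t - t') - 2 + r * (s' - s)) / (s + 1) := by
        rw [eq_div_iff hsp.ne', sub_mul, div_mul_cancel₀ _ hsp.ne']
        linear_combination -hrs
      rw [e1, abs_div, abs_of_pos hsp]
      refine div_le_div_of_nonneg_right ?_ hsp.le
      have d1 : |r * (s' - s)| ≤ B * W := by
        rw [abs_mul, abs_of_nonneg hr0]
        exact mul_le_mul hrB (abs_le.2 ⟨by linarith, by linarith⟩) (abs_nonneg _) hB0
      obtain ⟨d2, d3⟩ := abs_le.1 d1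
      exact abs_le.2 ⟨by linarith, by linarith⟩
    obtain ⟨d3, d4⟩ := abs_lt.1 hdiff
    rcases hmain with h | ⟨u, hu, h⟩
    · left
      linarith [min_le_left (ε / 2) (η / 2)]
    · right
      refine ⟨u, hu, ?_⟩
      have := abs_sub_le (((t : ℝ) - 1) / (s + 1)) r u
      linarith [min_le_right (ε / 2) (η / 2)]

end Recurrence

end LetterSubstitution

/-! ### The limit superior of a sequence near finitely many points. -/

section Limsup

/-- If, up to values close to `1`, a sequence accumulates only at finitely many points of a field of
real numbers, then its limit superior lies in this field. -/
theorem exists_limsup_eq_of_near_finite {x : ℕ → ℝ} (K : IntermediateField ℚ ℝ)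
    (hx : ∀ᶠ k in atTop, 1 ≤ x k)
    (h : ∀ ε : ℝ, 0 < ε → ∃ T : Set ℝ, T.Finite ∧ T ⊆ K ∧ ∀ η : ℝ, 0 < η →
      ∀ᶠ k in atTop, x k ≤ 1 + ε ∨ ∃ v ∈ T, |x k - v| < η) :
    ∃ α ∈ K, limsup (fun k => (x k : EReal)) atTop = (α : EReal) := by
  set L := limsup (fun k => (x k : EReal)) atTop with hL
  have hL1 : ((1 : ℝ) : EReal) ≤ L :=
    le_limsup_of_frequently_le (hx.frequently.mono fun k hk => EReal.coe_le_coe_iff.2 hk)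
  obtain ⟨b, hb⟩ : ∃ b : ℝ, L ≤ b := by
    obtain ⟨T, hT, -, hT'⟩ := h 1 one_pos
    obtain ⟨b, hb⟩ := hT.bddAbove
    refine ⟨max 2 (b + 1), limsup_le_of_le (by isBoundedDefault) ?_⟩
    filter_upwards [hT' 1 one_pos] with k hk
    refine EReal.coe_le_coe_iff.2 ?_
    rcases hk with hk | ⟨v, hv, hk⟩
    · exact le_trans (by linarith) (le_max_left _ _)
    · refine le_trans ?_ (le_max_right _ _)
      have := (abs_lt.1 hk).2
      linarith [hb hv]
  have hcoe : (L.toReal : EReal) = L :=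
    EReal.coe_toReal (ne_top_of_le_ne_top (EReal.coe_ne_top b) hb)
      (ne_bot_of_le_ne_bot (EReal.coe_ne_bot 1) hL1)
  set α := L.toReal with hα
  refine ⟨α, ?_, hcoe.symm⟩
  have hα1 : 1 ≤ α := by rw [← hcoe] at hL1; exact EReal.coe_le_coe_iff.1 hL1
  rcases hα1.eq_or_lt with h1 | h1
  · rw [← h1]; exact K.one_mem
  have hε : 0 < (α - 1) / 2 := by linarith
  obtain ⟨T, hT, hTK, hT'⟩ := h _ hε
  refine hTK ?_
  by_contra hαT
  obtain ⟨η, hη, hball⟩ := Metric.isOpen_iff.1 hT.isClosed.isOpen_compl α hαT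
  -- Infinitely many terms lie within δ of α: too large to be at most 1 + (α - 1)/2, and too far
  -- from T.
  set δ := min (η / 2) ((α - 1) / 2) with hδ
  have hδ0 : 0 < δ := lt_min (half_pos hη) hε
  have hlow : ∃ᶠ k in atTop, ((α - δ : ℝ) : EReal) < x k :=
    frequently_lt_of_lt_limsup (by isBoundedDefault) (by
      rw [← hL, ← hcoe]; exact EReal.coe_lt_coe_iff.2 (by linarith))
  have hup : ∀ᶠ k in atTop, (x k : EReal) < ((α + δ : ℝ) : EReal) :=
    eventually_lt_of_limsup_lt (by
      rw [← hL, ← hcoe]; exact EReal.coe_lt_coe_iff.2 (by linarith)) (by isBoundedDefault)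
  obtain ⟨k, hk1, hk2, hk3⟩ := (hlow.and_eventually (hup.and (hT' _ (half_pos hη)))).exists
  rw [EReal.coe_lt_coe_iff] at hk1 hk2
  have hδ1 : δ ≤ η / 2 := min_le_left _ _
  have hδ2 : δ ≤ (α - 1) / 2 := min_le_right _ _
  rcases hk3 with hk3 | ⟨v, hv, hk3⟩
  · linarith
  · refine hball (a := v) ?_ hv
    rw [Metric.mem_ball, Real.dist_eq]
    obtain ⟨h3, h4⟩ := abs_lt.1 hk3
    exact abs_lt.2 ⟨by linarith, by linarith⟩

end Limsup

/-! ### Maximal blocks and finite words. -/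

namespace MorphicWord

section Blocks

variable {A : Type*} {w : ℕ → A} {Δ : Set A}

theorem IsMaximalBlock.isGap {i j : ℕ} (h : IsMaximalBlock w Δ i j) (hi : 1 ≤ i) :
    IsGap w Δ (i - 1) (j + 1) := by
  obtain ⟨⟨hij, hin⟩, hj, hi'⟩ := h
  refine ⟨by omega, hi'.resolve_left (by omega), hj, fun n h1 h2 => hin n (by omega) (by omega)⟩

/-- If all starts were at most b, take n₀ > b outside Δ. A block of length at least n₀ + 2 ends
beyond n₀, and its letters beyond n₀ extend to a maximal block that cannot cross n₀. -/
theorem infinite_blockStarts (hinf : {n : ℕ | w n ∉ Δ}.Infinite)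
    (hunb : ∀ L : ℕ, ∃ i j : ℕ, IsBlock w Δ i j ∧ L ≤ j + 1 - i) :
    {i | ∃ j, IsMaximalBlock w Δ i j}.Infinite := by
  intro hfin
  obtain ⟨b, hb⟩ := hfin.bddAbove
  obtain ⟨n₀, hn₀, hbn₀⟩ := hinf.exists_gt b
  obtain ⟨i, j, ⟨hij, hblock⟩, hlen⟩ := hunb (n₀ + 2)
  have hjn : n₀ < j := by omega
  have hex : ∃ e, j ≤ e ∧ w (e + 1) ∉ Δ := by
    obtain ⟨e, he, hje⟩ := hinf.exists_gt j
    exact ⟨e - 1, by omega, by rwa [Nat.sub_add_cancel (by omega)]⟩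
  classical
  have he := Nat.find_spec hex
  set e := Nat.find hex
  have hall : ∀ n, j ≤ n → n ≤ e → w n ∈ Δ := by
    intro n h1 h2
    by_contra hn
    rcases h1.eq_or_lt with rfl | h1
    · exact hn (hblock _ hij le_rfl)
    · have := Nat.find_min hex (m := n - 1) (by change n - 1 < e; omega)
      exact this ⟨by omega, by rwa [Nat.sub_add_cancel (by omega)]⟩
  set d := Nat.findGreatest (fun d => ∀ n, j - d ≤ n → n ≤ j → w n ∈ Δ) j
  have hd0 : ∀ n, j - d ≤ n → n ≤ j → w n ∈ Δ :=
    Nat.findGreatest_spec (P := fun d => ∀ n, j - d ≤ n → n ≤ j → w n ∈ Δ) (Nat.zero_le j)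
      (fun n h1 h2 => hall n (by omega) (by omega))
  have hdj : d ≤ j := Nat.findGreatest_le j
  have hstart : n₀ < j - d := by
    by_contra! hcon
    exact hn₀ (hd0 n₀ hcon hjn.le)
  have hmax : IsMaximalBlock w Δ (j - d) e := by
    refine ⟨⟨by omega, fun n h1 h2 => ?_⟩, he.2, Or.inr fun hmem => ?_⟩
    · rcases le_total n j with h | h
      · exact hd0 n h1 h
      · exact hall n h h2
    · have hgr := Nat.le_findGreatest (P := fun d => ∀ n, j - d ≤ n → n ≤ j → w n ∈ Δ)
        (m := d + 1) (n := j) (by omega) (fun n h1 h2 => by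
          rcases Nat.lt_or_ge n (j - d) with h | h
          · rwa [show n = j - d - 1 by omega]
          · exact hd0 n h h2)
      omega
  have := hb ⟨e, hmax⟩
  omega

theorem isMaximalBlock_blockStart_blockEnd (h : {i | ∃ j, IsMaximalBlock w Δ i j}.Infinite)
    (k : ℕ) : IsMaximalBlock w Δ (blockStart w Δ k) (blockEnd w Δ k) :=
  Nat.sInf_mem (s := {j | IsMaximalBlock w Δ (blockStart w Δ k) j}) (Nat.nth_mem_of_infinite h k)

theorem tendsto_blockStart (h : {i | ∃ j, IsMaximalBlock w Δ i j}.Infinite) :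
    Tendsto (blockStart w Δ) atTop atTop := (Nat.nth_strictMono h).tendsto_atTop

end Blocks

section Words

variable {A : Type*}

/-- The prefix of length `m` of an infinite word. -/
def wordPrefix (w : ℕ → A) (m : ℕ) : FreeMonoid A := FreeMonoid.ofList ((List.range m).map w)

theorem wordPrefix_succ (w : ℕ → A) (m : ℕ) :
    wordPrefix w (m + 1) = wordPrefix w m * FreeMonoid.of (w m) := by
  rw [wordPrefix, List.range_succ, List.map_append, FreeMonoid.ofList_append]
  rfl

theorem isPrefixOf_of_mul {u v : FreeMonoid A} {w : ℕ → A} (h : IsPrefixOf (u * v) w) :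
    IsPrefixOf u w := by
  have h1 : u.toList ++ v.toList = (List.range (u.length + v.length)).map w := by
    rw [← FreeMonoid.length_mul]; exact h
  have h2 := congrArg (List.take u.toList.length) h1
  rw [List.take_left' rfl, ← List.map_take, List.take_range,
    Nat.min_eq_left (show u.toList.length ≤ u.length + v.length from Nat.le_add_right _ _)] at h2
  exact h2

theorem IsPrefixOf.eq_wordPrefix {u : FreeMonoid A} {w : ℕ → A} (h : IsPrefixOf u w) :
    u = wordPrefix w u.length := FreeMonoid.toList.injective h

theorem exists_wordPrefix_eq_mul (w : ℕ → A) {m n : ℕ} (h : m ≤ n) :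
    ∃ v, wordPrefix w n = wordPrefix w m * v := by
  induction n, h using Nat.le_induction with
  | base => exact ⟨1, (mul_one _).symm⟩
  | succ n _ ih =>
    obtain ⟨v, hv⟩ := ih
    exact ⟨v * FreeMonoid.of (w n), by rw [wordPrefix_succ, hv, mul_assoc]⟩

variable {h : FreeMonoid A →* FreeMonoid A}

theorem Nonerasing.length_le (hne : Nonerasing h) (u : FreeMonoid A) :
    u.length ≤ (h u).length := by
  induction u using FreeMonoid.inductionOn' with
  | one => simp
  | of_mul a u ih =>
    rw [map_mul, FreeMonoid.length_mul, FreeMonoid.length_mul, FreeMonoid.length_of]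
    have : (h (FreeMonoid.of a)).length ≠ 0 := fun h0 => hne a (FreeMonoid.length_eq_zero.1 h0)
    omega

theorem Nonerasing.length_le_iterate (hne : Nonerasing h) (n : ℕ) (u : FreeMonoid A) :
    u.length ≤ ((⇑h)^[n] u).length := by
  induction n with
  | zero => exact le_rfl
  | succ n ih => rw [Function.iterate_succ_apply']; exact ih.trans (hne.length_le _)

theorem Prolongable.lt_length_iterate {a : A} (ha : Prolongable h a) (n : ℕ) :
    n < ((⇑h)^[n] (FreeMonoid.of a)).length := by
  obtain ⟨x, hx, hx'⟩ := ha
  induction n with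
  | zero => simp
  | succ n ih =>
    rw [Function.iterate_succ_apply, hx, iterate_map_mul, FreeMonoid.length_mul]
    have : ((⇑h)^[n] x).length ≠ 0 := fun h0 => hx' n (FreeMonoid.length_eq_zero.1 h0)
    omega

/-- The prefix of length m is a prefix of the m-th iterate, whose image is the next iterate and thus
again a prefix of w. -/
theorem IsOmegaLimit.isPrefixOf_map {a : A} {w : ℕ → A} (hw : IsOmegaLimit h a w) (m : ℕ) :
    IsPrefixOf (h (wordPrefix w m)) w := by
  have h1 := (hw.2 m).eq_wordPrefix
  obtain ⟨v, hv⟩ := exists_wordPrefix_eq_mul w (hw.1.lt_length_iterate m).le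
  have h2 := hw.2 (m + 1)
  rw [Function.iterate_succ_apply', h1, hv, map_mul] at h2
  exact isPrefixOf_of_mul h2

theorem IsOmegaLimit.isPrefixOf_iterate {a : A} {w : ℕ → A} (hw : IsOmegaLimit h a w) (n m : ℕ) :
    IsPrefixOf ((⇑h)^[n] (wordPrefix w m)) w := by
  induction n with
  | zero => simp [IsPrefixOf, wordPrefix, FreeMonoid.length]
  | succ n ih =>
    rw [Function.iterate_succ_apply', ih.eq_wordPrefix]
    exact hw.isPrefixOf_map _

theorem forall_mem_iterate_iff (h : FreeMonoid A →* FreeMonoid A) (Δ : Set A) (n : ℕ)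
    (u : FreeMonoid A) : (∀ b ∈ ((⇑h)^[n] u).toList, b ∈ Δ) ↔
      ∀ c ∈ u.toList, ∀ b ∈ ((⇑h)^[n] (FreeMonoid.of c)).toList, b ∈ Δ := by
  induction u using FreeMonoid.inductionOn' with
  | one => simp [iterate_map_one]
  | of_mul a u ih =>
    rw [iterate_map_mul, FreeMonoid.toList_mul, FreeMonoid.toList_mul, List.forall_mem_append, ih,
      FreeMonoid.toList_of, List.singleton_append, List.forall_mem_cons]

/-- Some power of a morphism pulls `Δ` back to a set of letters that it pulls back to itself. -/
theorem exists_idempotent_preimage [Finite A] (h : FreeMonoid A →* FreeMonoid A) (Δ : Set A) :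
    ∃ p, 0 < p ∧ ∃ Γ : Set A, (∀ a, a ∈ Γ ↔ ∀ b ∈ ((⇑h)^[p] (FreeMonoid.of a)).toList, b ∈ Δ) ∧
      ∀ a, a ∈ Γ ↔ ∀ b ∈ ((⇑h)^[p] (FreeMonoid.of a)).toList, b ∈ Γ := by
  -- D (m + n) depends only on n and D m, so the sequence D is eventually periodic; a positive
  -- multiple p of the period past the preperiod satisfies D (p + p) = D p.
  let D : ℕ → Set A := fun n => {a | ∀ b ∈ ((⇑h)^[n] (FreeMonoid.of a)).toList, b ∈ Δ}
  have hD : ∀ m n a, a ∈ D (m + n) ↔ ∀ b ∈ ((⇑h)^[n] (FreeMonoid.of a)).toList, b ∈ D m := by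
    intro m n a
    change (∀ b ∈ ((⇑h)^[m + n] (FreeMonoid.of a)).toList, b ∈ Δ) ↔ _
    rw [Function.iterate_add_apply, forall_mem_iterate_iff]
    rfl
  have hadd : ∀ i j k, D i = D j → D (i + k) = D (j + k) := by
    intro i j k hij
    ext a
    rw [hD, hD, hij]
  obtain ⟨i, j, hne, hij⟩ := Finite.exists_ne_map_eq_of_infinite D
  wlog hlt : i < j generalizing i j
  · exact this j i hne.symm hij.symm (lt_of_le_of_ne (not_lt.1 hlt) hne.symm)
  obtain ⟨q, rfl⟩ := Nat.exists_eq_add_of_lt hlt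
  have hper : ∀ m l, D (i + m + (q + 1) * l) = D (i + m) := by
    intro m l
    induction l with
    | zero => rfl
    | succ l ih =>
      have := hadd _ _ (m + (q + 1) * l) hij
      rw [← add_assoc, ih] at this
      rw [this]
      congr 1
      ring
  refine ⟨(q + 1) * (i + 1), by positivity, D ((q + 1) * (i + 1)), fun a => Iff.rfl, fun a => ?_⟩
  rw [← hD]
  have := hper ((q + 1) * (i + 1) - i) (i + 1)
  have hle : i ≤ (q + 1) * (i + 1) := by nlinarith
  rw [Nat.add_sub_cancel' hle] at this
  rw [this]

theorem Uniform.exists_length_iterate (hu : Uniform h) (n : ℕ) :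
    ∃ M, ∀ a, ((⇑h)^[n] (FreeMonoid.of a)).length = M := by
  obtain ⟨m, hm⟩ := hu
  have hlen : ∀ u : FreeMonoid A, (h u).length = m * u.length := by
    intro u
    induction u using FreeMonoid.inductionOn' with
    | one => simp
    | of_mul a u ih =>
      rw [map_mul, FreeMonoid.length_mul, FreeMonoid.length_mul, FreeMonoid.length_of, hm, ih]
      ring
  refine ⟨m ^ n, fun a => ?_⟩
  induction n with
  | zero => simp
  | succ n ih => rw [Function.iterate_succ_apply', hlen, ih, pow_succ']

end Words

end MorphicWord

/-! ### From morphisms to substitutions, and the theorem. -/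

namespace LetterSubstitution

variable {A : Type*}

/-- The restriction of a substitution to the letters that occur in a fixed word. -/
noncomputable def restrict (S : LetterSubstitution A) (w : ℕ → A) :
    LetterSubstitution (Set.range w) where
  len a := S.len a
  -- Reading the image off an occurrence of the letter in w makes membership in the range automatic,
  -- even for r beyond the length.
  letter a r := ⟨w (S.imagePos w a.2.choose + r), Set.mem_range_self _⟩
  len_pos a := S.len_pos a

theorem coe_letter_restrict (S : LetterSubstitution A) {w : ℕ → A} (hw : S.Fixes w)
    (a : Set.range w) {r : ℕ} (hr : r < S.len a) :
    ((S.restrict w).letter a r : A) = S.letter a r := by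
  have h1 : w a.2.choose = a := a.2.choose_spec
  change w (S.imagePos w a.2.choose + r) = _
  rw [hw _ r (by rwa [h1]), h1]

theorem fixes_restrict (S : LetterSubstitution A) {w : ℕ → A} (hw : S.Fixes w) :
    (S.restrict w).Fixes (Set.rangeFactorization w) := by
  intro n r hr
  apply Subtype.ext
  rw [S.coe_letter_restrict hw _ hr]
  exact hw n r hr

/-- The substitution given by a power of a nonerasing morphism of words. -/
noncomputable def ofMorphism {h : FreeMonoid A →* FreeMonoid A} (hne : MorphicWord.Nonerasing h)
    (p : ℕ) : LetterSubstitution A where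
  len a := ((⇑h)^[p] (FreeMonoid.of a)).length
  -- The default a is used only for r beyond the length.
  letter a r := ((⇑h)^[p] (FreeMonoid.of a)).toList.getD r a
  len_pos a := Nat.lt_of_lt_of_le (by simp) (hne.length_le_iterate p _)

theorem fixes_ofMorphism {h : FreeMonoid A →* FreeMonoid A} (hne : MorphicWord.Nonerasing h)
    (p : ℕ) {a : A} {w : ℕ → A} (hw : MorphicWord.IsOmegaLimit h a w) :
    (ofMorphism hne p).Fixes w := by
  have hlen : ∀ m, ((⇑h)^[p] (MorphicWord.wordPrefix w m)).length
      = (ofMorphism hne p).imagePos w m := by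
    intro m
    induction m with
    | zero =>
      rw [show MorphicWord.wordPrefix w 0 = 1 from rfl, iterate_map_one]; rfl
    | succ m ih =>
      rw [MorphicWord.wordPrefix_succ, iterate_map_mul, FreeMonoid.length_mul, ih, imagePos_succ]
      rfl
  intro m r hr
  have h1 := hw.isPrefixOf_iterate p (m + 1)
  rw [MorphicWord.IsPrefixOf, hlen, MorphicWord.wordPrefix_succ, iterate_map_mul,
    FreeMonoid.toList_mul, imagePos_succ] at h1
  have h2 := congrArg (fun l => l[(ofMorphism hne p).imagePos w m + r]?) h1
  have h3 : ((⇑h)^[p] (MorphicWord.wordPrefix w m)).toList.length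
      = (ofMorphism hne p).imagePos w m := hlen m
  rw [List.getElem?_append_right (by omega), h3, Nat.add_sub_cancel_left, List.getElem?_map,
    List.getElem?_range (Nat.add_lt_add_left hr _)] at h2
  change _ = ((⇑h)^[p] (FreeMonoid.of (w m))).toList.getD r (w m)
  rw [List.getD_eq_getElem?_getD, h2]
  rfl

theorem forall_letter_ofMorphism_iff {h : FreeMonoid A →* FreeMonoid A}
    (hne : MorphicWord.Nonerasing h) (p : ℕ) (Δ : Set A) (a : A) :
    (∀ r < (ofMorphism hne p).len a, (ofMorphism hne p).letter a r ∈ Δ) ↔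
      ∀ b ∈ ((⇑h)^[p] (FreeMonoid.of a)).toList, b ∈ Δ := by
  rw [List.forall_mem_iff_getElem]
  refine forall_congr' fun r => forall_congr' fun hr => ?_
  change ((⇑h)^[p] (FreeMonoid.of a)).toList.getD r a ∈ Δ ↔ _
  rw [List.getD_eq_getElem _ _ hr]

/-- A letter outside Δ lies in the image of a letter outside Γ, and finitely many images cover only
finitely many positions. -/
theorem infinite_notMem_preimage (S : LetterSubstitution A) {w : ℕ → A} (hw : S.Fixes w)
    {Γ Δ : Set A} (hΔ : ∀ a, a ∈ Γ ↔ ∀ r < S.len a, S.letter a r ∈ Δ)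
    (hinf : {n | w n ∉ Δ}.Infinite) : {n | w n ∉ Γ}.Infinite := by
  intro hfin
  obtain ⟨b, hb⟩ := hfin.bddAbove
  obtain ⟨n, hn, hbn⟩ := hinf.exists_gt (S.imagePos w (b + 1))
  obtain ⟨m, r, hr, rfl⟩ := S.exists_eq_imagePos_add w n
  have hm : w m ∉ Γ := fun hmem => hn (by
    rw [hw m r hr]
    exact (hΔ _).1 hmem r hr)
  have := S.imagePos_add_lt_of_lt (Nat.lt_succ_of_le (hb hm)) hr
  rw [Nat.succ_eq_add_one] at this
  omega

end LetterSubstitution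

theorem theorem7 {A : Type*} [Fintype A] (h : FreeMonoid A →* FreeMonoid A)
    (hne : MorphicWord.Nonerasing h) (w : ℕ → A) (hw : MorphicWord.IsOmegaLimit h (w 0) w)
    (Δ : Set A) (hΔ : Δ.Nonempty) (hΔ' : Δ ⊂ Set.univ)
    (hinf : {n : ℕ | w n ∉ Δ}.Infinite)
    (hunb : ∀ L : ℕ, ∃ i j : ℕ, MorphicWord.IsBlock w Δ i j ∧ L ≤ j + 1 - i) :
    ∃ α : ℝ,
      Filter.limsup (fun k : ℕ =>
        (((MorphicWord.blockEnd w Δ k : ℝ) / (MorphicWord.blockStart w Δ k : ℝ) : ℝ) : EReal))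
        Filter.atTop = (α : EReal) ∧
      (IsAlgebraic ℚ α ∧ (minpoly ℚ α).natDegree ≤ Fintype.card A) ∧
      (MorphicWord.Uniform h → ∃ q : ℚ, α = (q : ℝ)) := by
  classical
  obtain ⟨p, hp, Γ, hΓΔ, hΓΓ⟩ := MorphicWord.exists_idempotent_preimage h Δ
  set S := LetterSubstitution.ofMorphism hne p with hS
  have hSw : S.Fixes w := LetterSubstitution.fixes_ofMorphism hne p hw
  have hpre : ∀ E : Set A, (∀ a, a ∈ Γ ↔ ∀ b ∈ ((⇑h)^[p] (FreeMonoid.of a)).toList, b ∈ E) →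
      ∀ a, a ∈ Γ ↔ ∀ r < S.len a, S.letter a r ∈ E := fun E hE a => by
    rw [hE, LetterSubstitution.forall_letter_ofMorphism_iff]
  have hres : ∀ E : Set A, (∀ a, a ∈ Γ ↔ ∀ b ∈ ((⇑h)^[p] (FreeMonoid.of a)).toList, b ∈ E) →
      ∀ a : Set.range w, a ∈ ((↑) ⁻¹' Γ : Set (Set.range w)) ↔
        ∀ r < (S.restrict w).len a, (S.restrict w).letter a r ∈ ((↑) ⁻¹' E : Set (Set.range w)) := by
    intro E hE a
    rw [Set.mem_preimage, hpre E hE]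
    refine forall_congr' fun r => forall_congr' fun hr => ?_
    rw [Set.mem_preimage, S.coe_letter_restrict hSw a hr]
  have hlen2 : 2 ≤ S.len (w 0) := lt_of_le_of_lt hp (hw.1.lt_length_iterate p)
  -- Passing to the letters that occur makes w surjective, as the growth comparison requires; the
  -- alphabet can only shrink, so the degree bound survives.
  obtain ⟨K, hK, hKA, hKu, hmain⟩ := (S.restrict w).exists_field_isGap_ratio
    (S.fixes_restrict hSw) Set.rangeFactorization_surjective hlen2 (hres Γ hΓΓ) (hres Δ hΓΔ)
    (S.infinite_notMem_preimage hSw (hpre Δ hΓΔ) hinf)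
  have hstarts := MorphicWord.infinite_blockStarts hinf hunb
  have hblock := MorphicWord.isMaximalBlock_blockStart_blockEnd hstarts
  have hto := MorphicWord.tendsto_blockStart hstarts
  obtain ⟨α, hαK, hα⟩ := exists_limsup_eq_of_near_finite
    (x := fun k => (MorphicWord.blockEnd w Δ k : ℝ) / (MorphicWord.blockStart w Δ k : ℝ)) K
    (by
      filter_upwards [hto.eventually_ge_atTop 1] with k hk
      rw [one_le_div (by exact_mod_cast hk)]
      exact_mod_cast (hblock k).1.1)
    (by
      intro ε hε
      obtain ⟨T, hT, hTK, hη⟩ := hmain ε hε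
      refine ⟨T, hT, hTK, fun η hη0 => ?_⟩
      obtain ⟨s₁, hs₁⟩ := hη η hη0
      filter_upwards [hto.eventually_ge_atTop (s₁ + 1)] with k hk
      -- With s = i - 1 and t = j + 1, the quotient (t - 1)/(s + 1) is exactly j/i.
      have hgap := (hblock k).isGap (by omega)
      have := hs₁ _ _ hgap (by omega)
      have e1 : ((MorphicWord.blockStart w Δ k - 1 : ℕ) : ℝ) + 1 = MorphicWord.blockStart w Δ k := by
        exact_mod_cast Nat.sub_add_cancel (by omega)
      rw [e1] at this
      simpa using this)
  have hmin : minpoly ℚ α = minpoly ℚ (⟨α, hαK⟩ : K) :=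
    (IntermediateField.minpoly_eq (⟨α, hαK⟩ : K)).symm
  have hint : IsIntegral ℚ α := by
    have := (Algebra.IsIntegral.isIntegral (R := ℚ) (⟨α, hαK⟩ : K)).map K.val
    exact this
  refine ⟨α, hα, ⟨hint.isAlgebraic, ?_⟩, fun hu => ?_⟩
  · rw [hmin]
    exact (minpoly.natDegree_le _).trans (hKA.trans (Fintype.card_le_of_injective _
      Subtype.val_injective))
  · obtain ⟨M, hM⟩ := hu.exists_length_iterate p
    rw [hKu ⟨M, fun a => hM a⟩, IntermediateField.mem_bot] at hαK
    obtain ⟨q, hq⟩ := hαK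
    exact ⟨q, by rw [← hq]; simp⟩
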